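/- **Setting.** Let $\mathbf D\in\mathbb R^{H\times L}$, $\mathbf B\in\mathbb R^{MN\times MN}$, $\mathbf S\in\mathbb R^{MN\times mn}$, $\mathbf R\in\mathbb R^{h\times H}$, $\mathcal Z\in\mathbb R^{M\times N\times h}$, and put $\mathcal H_{spa}(\mathcal X)=\mathrm{fold}_3(\mathcal X_{(3)}\mathbf{BS})$, $\mathcal H_{spec}(\mathcal X)=\mathrm{fold}_3(\mathbf R\mathcal X_{(3)})$ for $\mathcal X\in\mathbb R^{M\times N\times H}$, where $(\cdot)_{(3)}$ is the mode-3 unfolding and $\mathrm{fold}_3$ its inverse. Let $\mathcal Y$ be an image with $H$ bands of $m\times n$ pixels, each band $\mathcal Y_i$ given by a reconstruction $\mathbb R^2\to\mathbb R$, and let $T_\xi:\mathbb R^2\to\mathbb R^2$ $(\xi\in\mathbb R^p)$ be a family of transformations; $\mathcal Y_i\circ\xi$ is the $m\times n$ array of the values of $\mathcal Y_i\circ T_\xi$ at the pixels. Assume that $\xi\mapsto\mathrm{vec}(\mathcal Y_i\circ\xi)$ is twice continuously differentiable for each $i$. Fix parameters $\tau=(\tau_1,\dots,\tau_H)$, let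 $\mathcal Y\circ\tau\in\mathbb R^{m\times n\times H}$ have the bands $\mathcal Y_i\circ\tau_i$, let $\mathbf J_i$ be the Jacobian matrix of $\xi\mapsto \mathrm{vec}(\mathcal Y_i\circ\xi)$ at $\tau_i$, and for $\Delta\tau\in\mathbb R^{p\times H}$ let $\mathcal J(\Delta\tau)=\mathrm{fold}_3\big((\sum_{i=1}^H\mathbf J_i\Delta\tau\,\epsilon_i\epsilon_i^\top)^\top\big)$, with $\epsilon_i$ the standard basis of $\mathbb R^H$. Let $\|\mathcal L\|_{\mathrm{TNN}}$ be the average of the nuclear norms of the frontal slices of the discrete Fourier transform of $\mathcal L$ along the third mode. Consider $$\min_{\mathcal L,\Delta\tau,\mathbf A,\mathcal B}\ \|\mathcal L\|_{\mathrm{TNN}}\quad\text{s.t.}\quad \mathcal H_{spa}(\mathcal L\times_3\mathbf D)=\mathcal Y\circ\tau+\mathcal J(\Delta\tau),\qquad \mathcal H_{spec}(\mathcal L\times_3\mathbf D)=\mathcal Z\times_3\mathbf A+\mathcal B, \tag{P}$$ over $\mathcal L\in\mathbb R^{M\times N\times L}$, $\Delta\tau\in\mathbb R^{p\times H}$, $\mathbf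 A\in\mathbb R^{h\times h}$, $\mathcal B\in\mathbb R^{M\times N\times h}$, and assume that (P) is feasible. The dual of (P) is the maximization over $(\mathcal O_1,\mathcal O_2)$ of $$\inf_{\mathcal L,\Delta\tau,\mathbf A,\mathcal B}\ \|\mathcal L\|_{\mathrm{TNN}}+\langle\mathcal O_1,\mathcal H_{spa}(\mathcal L\times_3\mathbf D)-\mathcal Y\circ\tau-\mathcal J(\Delta\tau)\rangle+\langle\mathcal O_2,\mathcal H_{spec}(\mathcal L\times_3\mathbf D)-\mathcal Z\times_3\mathbf A-\mathcal B\rangle .$$ **Algorithm.** For $\mu_1,\mu_2>0$ let $$\Theta(\mathcal L,\Delta\tau,\mathbf A,\mathcal B,\mathcal O_1,\mathcal O_2)=\tfrac{\mu_1}2\big\|\mathcal H_{spa}(\mathcal L\times_3\mathbf D)-(\mathcal Y\circ\tau+\mathcal J(\Delta\tau))+\tfrac{\mathcal O_1}{\mu_1}\big\|_F^2+\tfrac{\mu_2}2\big\|\mathcal H_{spec}(\mathcal L\times_3\mathbf D)-(\mathcal Z\times_3\mathbf A+\mathcal B)+\tfrac{\mathcal O_2}{\mu_2}\big\|_F^2+\|\mathcal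 L\|_{\mathrm{TNN}} .$$ Assume that the minimization of $\Theta$ in $\mathcal L$ is well posed: for all $\Delta\tau,\mathbf A,\mathcal B,\mathcal O_1,\mathcal O_2$, the function $\Theta(\cdot,\Delta\tau,\mathbf A,\mathcal B,\mathcal O_1,\mathcal O_2)$ has at most one minimizer. Write $\dagger$ for the Moore–Penrose pseudoinverse, $$\mathrm T(\mathcal L,\mathcal O_1)=\sum_{i=1}^H\mathbf J_i^\dagger\big(\mathcal H_{spa}(\mathcal L\times_3\mathbf D)+\tfrac{\mathcal O_1}{\mu_1}-\mathcal Y\circ\tau\big)_{(3)}^{\top}\epsilon_i\epsilon_i^\top$$ (the least-norm minimizer of $\Theta$ in $\Delta\tau$), and $\mathbf Z=\begin{pmatrix}\mathcal Z_{(3)}\\ \mathbf I\end{pmatrix}$. From an arbitrary starting point, the symmetric Gauss–Seidel ADMM with step length $\rho$ computes, for $t=0,1,2,\dots$, $$\begin{aligned} \Delta\tau^{t+1/2}&=\mathrm T(\mathcal L^t,\mathcal O_1^t),\\ \mathcal L^{t+1}&=\arg\min_{\mathcal L}\Theta(\mathcal L,\Delta\tau^{t+1/2},\mathbf A^t,\mathcal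 B^t,\mathcal O_1^t,\mathcal O_2^t),\\ \Delta\tau^{t+1}&=\mathrm T(\mathcal L^{t+1},\mathcal O_1^t),\\ (\mathbf A^{t+1},\mathcal B^{t+1}_{(3)})&=\big(\mathcal H_{spec}(\mathcal L^{t+1}\times_3\mathbf D)+\tfrac{\mathcal O_2^t}{\mu_2}\big)_{(3)}\mathbf Z^\dagger,\\ \mathcal O_1^{t+1}&=\mathcal O_1^t+\rho\mu_1\big(\mathcal H_{spa}(\mathcal L^{t+1}\times_3\mathbf D)-(\mathcal Y\circ\tau+\mathcal J(\Delta\tau^{t+1}))\big),\\ \mathcal O_2^{t+1}&=\mathcal O_2^t+\rho\mu_2\big(\mathcal H_{spec}(\mathcal L^{t+1}\times_3\mathbf D)-(\mathcal Z\times_3\mathbf A^{t+1}+\mathcal B^{t+1})\big). \end{aligned}$$ **Theorem.** If $\rho\in(0,(1+\sqrt5)/2)$, then every sequence generated in this way satisfies: $(\mathcal L^t,\Delta\tau^t,(\mathbf A^t,\mathcal B^t))_t$ converges to an optimal solution of (P), and $(\mathcal O_1^t,\mathcal O_2^t)_t$ converges to an optimal solution of the dual of (P). -/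

import Mathlib

namespace RAF

/-- Real third-order tensors of size `a × b × c`. -/
abbrev Tensor (a b c : ℕ) : Type := Fin a → Fin b → Fin c → ℝ

/-- Mode-3 unfolding. The columns are indexed by the spatial positions `(i, j)`. -/
def unfold3 {a b c : ℕ} (X : Tensor a b c) : Matrix (Fin c) (Fin a × Fin b) ℝ :=
  Matrix.of fun k q => X q.1 q.2 k

/-- The inverse of the mode-3 unfolding. -/
def fold3 {a b c : ℕ} (X : Matrix (Fin c) (Fin a × Fin b) ℝ) : Tensor a b c :=
  fun i j k => X k (i, j)

/-- The mode-3 product `X ×₃ U`. -/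
def mode3 {a b c d : ℕ} (X : Tensor a b c) (U : Matrix (Fin d) (Fin c) ℝ) : Tensor a b d :=
  fold3 (U * unfold3 X)

/-- The Euclidean inner product of two tensors. -/
def tinner {a b c : ℕ} (X Y : Tensor a b c) : ℝ := ∑ i, ∑ j, ∑ k, X i j k * Y i j k

/-- The squared Frobenius norm of a tensor. -/
def frobSq {a b c : ℕ} (X : Tensor a b c) : ℝ := ∑ i, ∑ j, ∑ k, X i j k ^ 2

/-- The `r`-th frontal slice of `fft(X, [], 3)`. -/
noncomputable def fftSlice {a b c : ℕ} (X : Tensor a b c) (r : Fin c) :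
    Matrix (Fin a) (Fin b) ℂ :=
  Matrix.of fun i j => ∑ k : Fin c,
    (X i j k : ℂ) * Complex.exp (-2 * Real.pi * Complex.I * (r : ℕ) * (k : ℕ) / (c : ℂ))

/-- The nuclear norm: the sum of the singular values. -/
noncomputable def nuclearNorm {a b : ℕ} (A : Matrix (Fin a) (Fin b) ℂ) : ℝ :=
  ∑ s ∈ Finset.range b, (Matrix.toEuclideanLin A).singularValues s

/-- The tensor nuclear norm: the average of the nuclear norms of the frontal slices of the
Fourier transform along the third mode. -/
noncomputable def tnn {a b c : ℕ} (X : Tensor a b c) : ℝ :=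
  (1 / (c : ℝ)) * ∑ r : Fin c, nuclearNorm (fftSlice X r)

section PseudoInverse

variable {α β : Type*} [Fintype α] [Fintype β] [DecidableEq β]

/-- The Moore–Penrose pseudoinverse `(Aᵀ A)† Aᵀ`, where `(Aᵀ A)†` is obtained by inverting the
nonzero eigenvalues of `Aᵀ A` (note that `0⁻¹ = 0`). -/
noncomputable def pinv (A : Matrix α β ℝ) : Matrix β α ℝ :=
  let hA := Matrix.isHermitian_conjTranspose_mul_self A
  (hA.eigenvectorUnitary : Matrix β β ℝ) * Matrix.diagonal (fun j => (hA.eigenvalues j)⁻¹) *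
    (star (hA.eigenvectorUnitary : Matrix β β ℝ)) * A.transpose

/-- `pinv A` satisfies the four Penrose equations, which characterize the pseudoinverse. -/
theorem pinv_penrose (A : Matrix α β ℝ) :
    A * pinv A * A = A ∧ pinv A * A * pinv A = pinv A ∧
      (A * pinv A).transpose = A * pinv A ∧ (pinv A * A).transpose = pinv A * A := by
  classical
  have hA := Matrix.isHermitian_conjTranspose_mul_self A
  set U : Matrix β β ℝ := (hA.eigenvectorUnitary : Matrix β β ℝ) with hU
  set G : Matrix β β ℝ := U * Matrix.diagonal (fun j => (hA.eigenvalues j)⁻¹) * star U with hG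
  have hP : pinv A = G * A.transpose := rfl
  have hUU : star U * U = 1 := Unitary.coe_star_mul_self hA.eigenvectorUnitary
  have hS : A.transpose * A = U * Matrix.diagonal hA.eigenvalues * star U := by
    have := hA.spectral_theorem
    rw [Unitary.conjStarAlgAut_apply] at this
    rw [← Matrix.conjTranspose_eq_transpose_of_trivial, hU]
    exact this
  have hmul : ∀ f g : β → ℝ, (U * Matrix.diagonal f * star U) * (U * Matrix.diagonal g * star U)
      = U * Matrix.diagonal (fun j => f j * g j) * star U := by
    intro f g
    calc _ = U * Matrix.diagonal f * (star U * U) * Matrix.diagonal g * star U := by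
          simp only [Matrix.mul_assoc]
      _ = _ := by rw [hUU, Matrix.mul_one, Matrix.mul_assoc U, Matrix.diagonal_mul_diagonal]
  have hsymm : ∀ f : β → ℝ, (U * Matrix.diagonal f * star U).transpose
      = U * Matrix.diagonal f * star U := by
    intro f
    simp [Matrix.star_eq_conjTranspose, Matrix.conjTranspose_eq_transpose_of_trivial,
      Matrix.transpose_mul, Matrix.mul_assoc]
  set E : Matrix β β ℝ := G * (A.transpose * A) with hE
  have hE' : E = U * Matrix.diagonal (fun j => (hA.eigenvalues j)⁻¹ * hA.eigenvalues j) * star U := by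
    rw [hE, hS, hG, hmul]
  have hEs : E.transpose = E := by rw [hE']; exact hsymm _
  have hSE : A.transpose * A * E = A.transpose * A := by
    rw [hE', hS, hmul]
    congr 3
    funext j
    exact (mul_assoc _ _ _).symm.trans (mul_inv_mul_cancel _)
  have hEG : E * G = G := by
    have key : ∀ x : ℝ, x⁻¹ * x * x⁻¹ = x⁻¹ := fun x => by
      by_cases h : x = 0 <;> simp [h]
    rw [hE', hG, hmul]
    congr 3
    funext j
    exact key _
  have hAE : A * E = A := by
    have h0 : (A * E - A).conjTranspose * (A * E - A) = 0 := by
      rw [Matrix.conjTranspose_eq_transpose_of_trivial, Matrix.transpose_sub,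
        Matrix.transpose_mul, hEs, Matrix.sub_mul, Matrix.mul_sub, Matrix.mul_sub]
      have h1 : E * A.transpose * (A * E) = E * (A.transpose * A * E) := by
        simp only [Matrix.mul_assoc]
      have h2 : A.transpose * (A * E) = A.transpose * A * E := by
        simp only [Matrix.mul_assoc]
      rw [h1, h2, hSE, Matrix.mul_assoc E, sub_self, sub_self, sub_self]
    exact sub_eq_zero.mp (Matrix.conjTranspose_mul_self_eq_zero.mp h0)
  have hPA : pinv A * A = E := by rw [hP, hE, Matrix.mul_assoc]
  refine ⟨?_, ?_, ?_, ?_⟩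
  · rw [Matrix.mul_assoc, hPA, hAE]
  · rw [hPA, hP, ← Matrix.mul_assoc, hEG]
  · rw [hP, Matrix.transpose_mul, Matrix.transpose_mul, Matrix.transpose_transpose, hG, hsymm,
      Matrix.mul_assoc A]
  · rw [hPA, hEs]

end PseudoInverse

/-- The data of the linearized registration-and-fusion subproblem. -/
structure Data (M N H m n h L p : ℕ) where
  /-- the spectral dictionary -/
  D : Matrix (Fin H) (Fin L) ℝ
  /-- the spatial blurring matrix -/
  B : Matrix (Fin M × Fin N) (Fin M × Fin N) ℝ
  /-- the spatial downsampling matrix -/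
  S : Matrix (Fin M × Fin N) (Fin m × Fin n) ℝ
  /-- the spectral downsampling matrix -/
  R : Matrix (Fin h) (Fin H) ℝ
  /-- the multispectral image -/
  Z : Tensor M N h
  /-- the image `𝒴`: for each band, the continuous reconstruction, whose samples at the pixels
  `(i, j)` are the entries of the band -/
  Y : Fin H → ℝ × ℝ → ℝ
  /-- the family of planar transformations, parametrized by `ξ ∈ ℝᵖ` -/
  T : (Fin p → ℝ) → ℝ × ℝ → ℝ × ℝ
  /-- the current transformation parameters, one vector for each band -/
  τ : Fin H → Fin p → ℝ

namespace Data

variable {M N H m n h L p : ℕ} (P : Data M N H m n h L p)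

/-- `ξ ↦ vec(𝒴_b ∘ ξ)`: band `b` warped by the transformation with parameters `ξ` and resampled
at the pixels. -/
def warpBand (b : Fin H) (ξ : Fin p → ℝ) : Fin m × Fin n → ℝ :=
  fun q => P.Y b (P.T ξ (((q.1 : ℕ) : ℝ), ((q.2 : ℕ) : ℝ)))

/-- The warped image `𝒴 ∘ τ`. -/
def warped : Tensor m n H := fun i j b => P.warpBand b (P.τ b) (i, j)

/-- The Jacobian matrix of `ξ ↦ vec(𝒴_b ∘ ξ)` at `τ_b`. -/
noncomputable def jac (b : Fin H) : Matrix (Fin m × Fin n) (Fin p) ℝ :=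
  LinearMap.toMatrix' (fderiv ℝ (P.warpBand b) (P.τ b) : (Fin p → ℝ) →ₗ[ℝ] (Fin m × Fin n → ℝ))

/-- `𝒥(Δτ) = fold₃((∑ᵢ Jᵢ Δτ εᵢ εᵢᵀ)ᵀ)`. -/
noncomputable def J (Δτ : Matrix (Fin p) (Fin H) ℝ) : Tensor m n H :=
  fold3 (∑ b : Fin H, P.jac b * Δτ * Matrix.single b b (1 : ℝ)).transpose

/-- The spatial degradation operator. -/
def Hspa (X : Tensor M N H) : Tensor m n H := fold3 (unfold3 X * (P.B * P.S))

/-- The spectral degradation operator. -/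
def Hspec (X : Tensor M N H) : Tensor M N h := fold3 (P.R * unfold3 X)

/-- `ℋ_spa(ℒ ×₃ D) - (𝒴∘τ + 𝒥(Δτ))`, the residual of the first constraint. -/
noncomputable def res1 (X : Tensor M N L) (Δτ : Matrix (Fin p) (Fin H) ℝ) : Tensor m n H :=
  P.Hspa (mode3 X P.D) - (P.warped + P.J Δτ)

/-- `ℋ_spec(ℒ ×₃ D) - (𝒵 ×₃ A + ℬ)`, the residual of the second constraint. -/
def res2 (X : Tensor M N L) (A : Matrix (Fin h) (Fin h) ℝ) (C : Tensor M N h) : Tensor M N h :=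
  P.Hspec (mode3 X P.D) - (mode3 P.Z A + C)

/-- Feasibility of `(ℒ, Δτ, A, ℬ)` for the linearized subproblem. -/
def Feasible (X : Tensor M N L) (Δτ : Matrix (Fin p) (Fin H) ℝ)
    (A : Matrix (Fin h) (Fin h) ℝ) (C : Tensor M N h) : Prop :=
  P.Hspa (mode3 X P.D) = P.warped + P.J Δτ ∧ P.Hspec (mode3 X P.D) = mode3 P.Z A + C

/-- `(ℒ, Δτ, A, ℬ)` minimizes `‖ℒ‖_TNN` over the feasible set. -/
def IsPrimalOptimal (X : Tensor M N L) (Δτ : Matrix (Fin p) (Fin H) ℝ)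
    (A : Matrix (Fin h) (Fin h) ℝ) (C : Tensor M N h) : Prop :=
  P.Feasible X Δτ A C ∧ ∀ X' Δτ' A' C', P.Feasible X' Δτ' A' C' → tnn X ≤ tnn X'

/-- The (ordinary) Lagrangian. -/
noncomputable def lagrangian (X : Tensor M N L) (Δτ : Matrix (Fin p) (Fin H) ℝ)
    (A : Matrix (Fin h) (Fin h) ℝ) (C : Tensor M N h)
    (O₁ : Tensor m n H) (O₂ : Tensor M N h) : ℝ :=
  tnn X + tinner O₁ (P.res1 X Δτ) + tinner O₂ (P.res2 X A C)

/-- The Lagrange dual function, with values in `[-∞, ∞]`. -/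
noncomputable def dual (O₁ : Tensor m n H) (O₂ : Tensor M N h) : EReal :=
  ⨅ (X : Tensor M N L) (Δτ : Matrix (Fin p) (Fin H) ℝ) (A : Matrix (Fin h) (Fin h) ℝ)
    (C : Tensor M N h), ((P.lagrangian X Δτ A C O₁ O₂ : ℝ) : EReal)

/-- `(O₁, O₂)` maximizes the Lagrange dual function. -/
def IsDualOptimal (O₁ : Tensor m n H) (O₂ : Tensor M N h) : Prop :=
  ∀ O₁' O₂', P.dual O₁' O₂' ≤ P.dual O₁ O₂

/-- The augmented Lagrangian `Θ`. -/
noncomputable def Θ (μ₁ μ₂ : ℝ) (X : Tensor M N L) (Δτ : Matrix (Fin p) (Fin H) ℝ)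
    (A : Matrix (Fin h) (Fin h) ℝ) (C : Tensor M N h)
    (O₁ : Tensor m n H) (O₂ : Tensor M N h) : ℝ :=
  μ₁ / 2 * frobSq (P.res1 X Δτ + μ₁⁻¹ • O₁) + μ₂ / 2 * frobSq (P.res2 X A C + μ₂⁻¹ • O₂) + tnn X

/-- The update of `Δτ`: `∑ᵢ Jᵢ† (ℋ_spa(ℒ ×₃ D) + O₁/μ₁ - 𝒴∘τ)₍₃₎ᵀ εᵢ εᵢᵀ`, the least-norm
minimizer of `Θ` in `Δτ`. -/
noncomputable def stepτ (μ₁ : ℝ) (X : Tensor M N L) (O₁ : Tensor m n H) :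
    Matrix (Fin p) (Fin H) ℝ :=
  ∑ b : Fin H, pinv (P.jac b) *
    (unfold3 (P.Hspa (mode3 X P.D) + μ₁⁻¹ • O₁ - P.warped)).transpose * Matrix.single b b (1 : ℝ)

/-- The block matrix with rows `𝒵₍₃₎` and `I`, so that
`(𝒵 ×₃ A + ℬ)₍₃₎ = (A, ℬ₍₃₎) * stackZ`. -/
def stackZ : Matrix (Fin h ⊕ (Fin M × Fin N)) (Fin M × Fin N) ℝ :=
  Matrix.fromRows (unfold3 P.Z) 1

/-- The update of `(A, ℬ₍₃₎)`: `(ℋ_spec(ℒ ×₃ D) + O₂/μ₂)₍₃₎` times the pseudoinverse of `stackZ`,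
the least-norm minimizer of `Θ` in `(A, ℬ)`. -/
noncomputable def stepAB (μ₂ : ℝ) (X : Tensor M N L) (O₂ : Tensor M N h) :
    Matrix (Fin h) (Fin h ⊕ (Fin M × Fin N)) ℝ :=
  unfold3 (P.Hspec (mode3 X P.D) + μ₂⁻¹ • O₂) * pinv P.stackZ

/-- The sequences are generated by the symmetric Gauss–Seidel ADMM with penalty parameters
`μ₁, μ₂` and step length `ρ`, from an arbitrary starting point. -/
structure IsSGSADMM (μ₁ μ₂ ρ : ℝ) (X : ℕ → Tensor M N L) (Δτ : ℕ → Matrix (Fin p) (Fin H) ℝ)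
    (A : ℕ → Matrix (Fin h) (Fin h) ℝ) (C : ℕ → Tensor M N h)
    (O₁ : ℕ → Tensor m n H) (O₂ : ℕ → Tensor M N h) : Prop where
  /-- `ℒᵗ⁺¹` minimizes `Θ(·, Δτᵗ⁺¹ᐟ², Aᵗ, ℬᵗ, O₁ᵗ, O₂ᵗ)`, with `Δτᵗ⁺¹ᐟ²` computed from `ℒᵗ`. -/
  step_L : ∀ t, IsMinOn (fun X' => P.Θ μ₁ μ₂ X' (P.stepτ μ₁ (X t) (O₁ t)) (A t) (C t)
    (O₁ t) (O₂ t)) Set.univ (X (t + 1))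
  step_τ : ∀ t, Δτ (t + 1) = P.stepτ μ₁ (X (t + 1)) (O₁ t)
  step_A : ∀ t, A (t + 1) = (P.stepAB μ₂ (X (t + 1)) (O₂ t)).toCols₁
  step_C : ∀ t, C (t + 1) = fold3 (P.stepAB μ₂ (X (t + 1)) (O₂ t)).toCols₂
  step_O₁ : ∀ t, O₁ (t + 1) = O₁ t + (ρ * μ₁) • P.res1 (X (t + 1)) (Δτ (t + 1))
  step_O₂ : ∀ t, O₂ (t + 1) = O₂ t + (ρ * μ₂) • P.res2 (X (t + 1)) (A (t + 1)) (C (t + 1))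

end Data

end RAF

/-! The blocks Δτ and (𝐀, ℬ) can be eliminated. Let Π be the orthogonal projection onto the range of
𝒥 (`projJ`). After the update of Δτ, the first residual is the (I − Π)-part of ℋ_spa(ℒ ×₃ 𝐃) − 𝒴∘τ
minus Π𝒪₁/μ₁. Since 𝐙 contains an identity block, (𝐀, ℬ) absorbs the second constraint entirely, and
its residual is −𝒪₂/μ₂. Hence each iteration multiplies Π𝒪₁ and 𝒪₂ by 1 − ρ, and both tend to 0
because 0 < ρ < 2 (`projJ_O₁`, `O₂_eq`).

What remains is an iteration in ℒ and (I − Π)𝒪₁. Substituting the half step Δτᵗ⁺¹ᐟ² turns it into a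
proximal augmented Lagrangian method for minimizing the tensor nuclear norm subject to the (I −
Π)-part of the first constraint. The semi-proximal terms come from Πℋ_spa and ℋ_spec, and the error
is geometrically small, being a multiple of an earlier 𝒪₂ (`isProxAugLagrangian`).

The weighted distance to any Karush–Kuhn–Tucker pair is quasi-Fejér monotone for every ρ in (0, 2),
an interval containing the stated one (`distSq_add_decrease_le`, `quasiFejer`). Since the objective
is a norm, the iterates are bounded; their cluster points are Karush–Kuhn–Tucker pairs, and the
distance to one of these tends to 0 (`exists_tendsto`). This distance sees ℒ only through two linear
maps; the missing uniqueness follows from the well-posedness of the ℒ-step (`eq_of_isKKT`). The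
other blocks converge as continuous functions of ℒ and the multipliers. -/

namespace RAF

/-! ### Sums of singular values: triangle inequality and homogeneity by duality. -/

section NuclearNorm

variable {𝕜 E F : Type*} [RCLike 𝕜] [NormedAddCommGroup E] [InnerProductSpace 𝕜 E]
  [NormedAddCommGroup F] [InnerProductSpace 𝕜 F]

/-- Bessel's inequality, as a property of a finite family of vectors. -/
def IsBessel (𝕜 : Type*) {ι F : Type*} [Fintype ι] [RCLike 𝕜] [NormedAddCommGroup F]
    [InnerProductSpace 𝕜 F] (u : ι → F) : Prop :=
  ∀ y, ∑ i, ‖inner 𝕜 (u i) y‖ ^ 2 ≤ ‖y‖ ^ 2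

theorem isBessel_of_orthogonal {ι : Type*} [Fintype ι] (u : ι → F)
    (h1 : ∀ i, u i = 0 ∨ ‖u i‖ = 1) (h2 : ∀ i j, i ≠ j → inner 𝕜 (u i) (u j) = 0) :
    IsBessel 𝕜 u := by
  classical
  intro y
  have ho : Orthonormal 𝕜 (fun i : {i // u i ≠ 0} => u i) :=
    ⟨fun i => (h1 i).resolve_left i.2, fun i j hij => h2 _ _ fun h => hij (Subtype.ext h)⟩
  have hb := ho.sum_inner_products_le y (s := Finset.univ)
  refine le_trans (le_of_eq ?_) hb
  rw [← Finset.sum_subtype (Finset.univ.filter (u · ≠ 0)) (by simp)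
    (fun i => ‖inner 𝕜 (u i) y‖ ^ 2), Finset.sum_filter]
  refine Finset.sum_congr rfl fun i _ => ?_
  by_cases h : u i = 0 <;> simp [h]

variable [FiniteDimensional 𝕜 E] [FiniteDimensional 𝕜 F]

/-- The left vectors are σᵢ⁻¹ T vᵢ, with 0⁻¹ = 0. Those with σᵢ = 0 vanish and cannot always be
completed to an orthonormal family, since `F` may have dimension below `n`; Bessel's inequality is
what survives. -/
theorem exists_singularValue_decomposition {n : ℕ} (hn : Module.finrank 𝕜 E = n)
    (T : E →ₗ[𝕜] F) :
    ∃ (v : OrthonormalBasis (Fin n) 𝕜 E) (u : Fin n → F), IsBessel 𝕜 u ∧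
      (∀ i, u i = 0 ∨ ‖u i‖ = 1) ∧
      ∀ i : Fin n, T (v i) = (T.singularValues i : 𝕜) • u i ∧
        inner 𝕜 (u i) (T (v i)) = (T.singularValues i : 𝕜) := by
  set v := T.isSymmetric_adjoint_comp_self.eigenvectorBasis hn with hv
  have hin : ∀ i j, inner 𝕜 (T (v i)) (T (v j)) =
      if i = j then (T.singularValues j : 𝕜) ^ 2 else 0 := by
    intro i j
    have h := T.isSymmetric_adjoint_comp_self.apply_eigenvectorBasis hn j
    rw [← LinearMap.adjoint_inner_right, ← LinearMap.comp_apply, hv, h, inner_smul_right,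
      ← T.sq_singularValues_fin hn, ← hv, orthonormal_iff_ite.mp v.orthonormal]
    split_ifs <;> simp
  have hnorm : ∀ i, ‖T (v i)‖ = T.singularValues i := by
    intro i
    have h := hin i i
    rw [if_pos rfl, inner_self_eq_norm_sq_to_K] at h
    have h' : ‖T (v i)‖ ^ 2 = T.singularValues i ^ 2 := by exact_mod_cast h
    exact (sq_eq_sq₀ (norm_nonneg _) (T.singularValues_nonneg i)).mp h'
  have hunit : ∀ i : Fin n, (T.singularValues i : 𝕜)⁻¹ • T (v i) = 0 ∨
      ‖(T.singularValues i : 𝕜)⁻¹ • T (v i)‖ = 1 := by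
    intro i
    by_cases h : T.singularValues i = 0
    · simp [h]
    · right
      rw [norm_smul, hnorm, norm_inv, RCLike.norm_ofReal, abs_of_nonneg (T.singularValues_nonneg i),
        inv_mul_cancel₀ h]
  refine ⟨v, fun i => (T.singularValues i : 𝕜)⁻¹ • T (v i), isBessel_of_orthogonal _ hunit ?_,
    hunit, fun i => ⟨?_, ?_⟩⟩
  · intro i j hij
    simp [inner_smul_left, inner_smul_right, hin, hij]
  · by_cases h : T.singularValues i = 0
    · rw [h]
      simpa [h] using hnorm i
    · rw [smul_inv_smul₀ (by exact_mod_cast h)]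
  · rw [inner_smul_left, hin, if_pos rfl]
    by_cases h : T.singularValues i = 0
    · simp [h]
    · have h' : (T.singularValues i : 𝕜) ≠ 0 := by exact_mod_cast h
      simp only [map_inv₀, RCLike.conj_ofReal]
      field_simp

/-- Expanding wᵢ in the right singular vectors gives each σⱼ a coefficient ∑ᵢ ⟨vⱼ, wᵢ⟩⟨xᵢ, uⱼ⟩,
which is at most 1 in modulus by Cauchy–Schwarz, Parseval for `w` and Bessel for `x`. With equality
at the singular vectors, this presents the nuclear norm as a maximum of real-linear functionals,
hence as subadditive. -/
theorem re_sum_inner_le_sum_singularValues {n : ℕ} (hn : Module.finrank 𝕜 E = n)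
    (T : E →ₗ[𝕜] F) (w : OrthonormalBasis (Fin n) 𝕜 E) (x : Fin n → F) (hx : IsBessel 𝕜 x) :
    RCLike.re (∑ i, inner 𝕜 (x i) (T (w i))) ≤ ∑ i : Fin n, T.singularValues i := by
  obtain ⟨v, u, -, hu1, hT⟩ := exists_singularValue_decomposition hn T
  have hexp : ∀ i, inner 𝕜 (x i) (T (w i)) =
      ∑ j : Fin n, (T.singularValues j : 𝕜) * (inner 𝕜 (v j) (w i) * inner 𝕜 (x i) (u j)) := by
    intro i
    conv_lhs => rw [← v.sum_repr' (w i)]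
    simp only [map_sum, map_smul, inner_sum, inner_smul_right, (hT _).1]
    exact Finset.sum_congr rfl fun j _ => by ring
  have hcs : ∀ j, ∑ i, ‖inner 𝕜 (v j) (w i)‖ * ‖inner 𝕜 (x i) (u j)‖ ≤ 1 := by
    intro j
    have h1 := Real.sum_mul_le_sqrt_mul_sqrt Finset.univ (fun i => ‖inner 𝕜 (v j) (w i)‖)
      (fun i => ‖inner 𝕜 (x i) (u j)‖)
    have h2 : √(∑ i, ‖inner 𝕜 (v j) (w i)‖ ^ 2) ≤ 1 := by
      rw [w.sum_sq_norm_inner_left]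
      simp
    have h3 : √(∑ i, ‖inner 𝕜 (x i) (u j)‖ ^ 2) ≤ 1 := by
      rw [Real.sqrt_le_one]
      refine (hx (u j)).trans ?_
      rcases hu1 j with h | h <;> simp [h]
    exact h1.trans (mul_le_one₀ h2 (Real.sqrt_nonneg _) h3)
  calc RCLike.re (∑ i, inner 𝕜 (x i) (T (w i)))
      ≤ ‖∑ i, inner 𝕜 (x i) (T (w i))‖ := RCLike.re_le_norm _
    _ = ‖∑ j : Fin n, (T.singularValues j : 𝕜) *
          ∑ i, inner 𝕜 (v j) (w i) * inner 𝕜 (x i) (u j)‖ := by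
        simp only [hexp, Finset.mul_sum]
        rw [Finset.sum_comm]
    _ ≤ ∑ j : Fin n, T.singularValues j * 1 := by
        refine (norm_sum_le _ _).trans (Finset.sum_le_sum fun j _ => ?_)
        rw [norm_mul, RCLike.norm_ofReal, abs_of_nonneg (T.singularValues_nonneg j)]
        refine mul_le_mul_of_nonneg_left ?_ (T.singularValues_nonneg j)
        refine (norm_sum_le _ _).trans (le_trans (le_of_eq ?_) (hcs j))
        simp [norm_mul]
    _ = _ := by simp

theorem sum_singularValues_add_le {n : ℕ} (hn : Module.finrank 𝕜 E = n) (S T : E →ₗ[𝕜] F) :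
    ∑ i : Fin n, (S + T).singularValues i ≤
      ∑ i : Fin n, S.singularValues i + ∑ i : Fin n, T.singularValues i := by
  obtain ⟨v, u, hu, -, h⟩ := exists_singularValue_decomposition hn (S + T)
  have hS := re_sum_inner_le_sum_singularValues hn S v u hu
  have hT := re_sum_inner_le_sum_singularValues hn T v u hu
  refine le_trans (le_of_eq ?_) (add_le_add hS hT)
  rw [← map_add, ← Finset.sum_add_distrib]
  simp only [← inner_add_right, ← LinearMap.add_apply, (h _).2]
  simp

theorem sum_singularValues_smul_le {n : ℕ} (hn : Module.finrank 𝕜 E = n) (c : ℝ)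
    (T : E →ₗ[𝕜] F) :
    ∑ i : Fin n, ((c : 𝕜) • T).singularValues i ≤ |c| * ∑ i : Fin n, T.singularValues i := by
  obtain ⟨v, u, hu, -, h⟩ := exists_singularValue_decomposition hn ((c : 𝕜) • T)
  -- The sign of `c` is moved into the left vectors, which preserves Bessel's inequality.
  obtain ⟨s, hs, hsc⟩ : ∃ s : ℝ, |s| = 1 ∧ c = |c| * s := by
    rcases le_total 0 c with h | h
    · exact ⟨1, by simp, by simp [abs_of_nonneg h]⟩
    · exact ⟨-1, by simp, by simp [abs_of_nonpos h]⟩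
  have hu' : IsBessel 𝕜 fun i => (s : 𝕜) • u i := by
    intro y
    simpa [inner_smul_left, hs] using hu y
  have hT := re_sum_inner_le_sum_singularValues hn T v _ hu'
  refine le_trans (le_of_eq ?_) (mul_le_mul_of_nonneg_left hT (abs_nonneg c))
  have h1 : ∀ i : Fin n, ((((c : 𝕜) • T).singularValues i : ℝ) : 𝕜) =
      (|c| : ℝ) * inner 𝕜 ((s : 𝕜) • u i) (T (v i)) := by
    intro i
    rw [← (h i).2, LinearMap.smul_apply, inner_smul_right, inner_smul_left]
    conv_lhs => rw [hsc]
    simp [mul_assoc]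
  rw [← RCLike.re_ofReal_mul, Finset.mul_sum]
  simp only [← h1]
  rw [← RCLike.ofReal_sum, RCLike.ofReal_re]

end NuclearNorm

/-! ### The tensor nuclear norm is a norm. -/

variable {a b c : ℕ}

theorem nuclearNorm_eq_sum_fin (A : Matrix (Fin a) (Fin b) ℂ) :
    nuclearNorm A = ∑ i : Fin b, (Matrix.toEuclideanLin A).singularValues i :=
  Finset.sum_range _

theorem nuclearNorm_add_le (A B : Matrix (Fin a) (Fin b) ℂ) :
    nuclearNorm (A + B) ≤ nuclearNorm A + nuclearNorm B := by
  simp only [nuclearNorm_eq_sum_fin, map_add]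
  exact sum_singularValues_add_le (by simp) _ _

theorem nuclearNorm_smul_le (r : ℝ) (A : Matrix (Fin a) (Fin b) ℂ) :
    nuclearNorm ((r : ℂ) • A) ≤ |r| * nuclearNorm A := by
  simp only [nuclearNorm_eq_sum_fin, map_smul]
  exact sum_singularValues_smul_le (𝕜 := ℂ) (by simp) _ _

theorem nuclearNorm_nonneg (A : Matrix (Fin a) (Fin b) ℂ) : 0 ≤ nuclearNorm A :=
  Finset.sum_nonneg fun _ _ => LinearMap.singularValues_nonneg _ _

theorem nuclearNorm_zero : nuclearNorm (0 : Matrix (Fin a) (Fin b) ℂ) = 0 := by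
  simp [nuclearNorm]

theorem eq_zero_of_nuclearNorm_eq_zero {A : Matrix (Fin a) (Fin b) ℂ} (h : nuclearNorm A = 0) :
    A = 0 := by
  rw [nuclearNorm, Finset.sum_eq_zero_iff_of_nonneg
    (fun _ _ => LinearMap.singularValues_nonneg _ _)] at h
  rw [← (Matrix.toEuclideanLin (𝕜 := ℂ)).map_eq_zero_iff, ← LinearMap.singularValues_eq_zero_iff]
  ext i
  by_cases hi : i < b
  · exact h i (Finset.mem_range.mpr hi)
  · exact LinearMap.singularValues_of_finrank_le _ (by simpa using hi)

theorem fftSlice_add (X Y : Tensor a b c) (r : Fin c) :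
    fftSlice (X + Y) r = fftSlice X r + fftSlice Y r := by
  ext i j
  simp [fftSlice, add_mul, Finset.sum_add_distrib]

theorem fftSlice_smul (s : ℝ) (X : Tensor a b c) (r : Fin c) :
    fftSlice (s • X) r = (s : ℂ) • fftSlice X r := by
  ext i j
  simp [fftSlice, Finset.mul_sum, mul_assoc]

/-- The discrete Fourier transform is injective. -/
theorem eq_zero_of_fftSlice_eq_zero {X : Tensor a b c} (h : ∀ r, fftSlice X r = 0) : X = 0 := by
  rcases Nat.eq_zero_or_pos c with rfl | hc
  · funext i j k
    exact k.elim0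
  set w : Fin c → ℂ := fun r => Complex.exp (-2 * Real.pi * Complex.I * (r : ℕ) / (c : ℂ)) with hw
  have hprim := (Complex.isPrimitiveRoot_exp c hc.ne').inv
  have hw' : ∀ r : Fin c, w r = (Complex.exp (2 * Real.pi * Complex.I / c))⁻¹ ^ (r : ℕ) := by
    intro r
    simp only [hw]
    rw [← Complex.exp_neg, ← Complex.exp_nat_mul]
    congr 1
    ring
  have hinj : Function.Injective w := by
    intro r s hrs
    rw [hw', hw'] at hrs
    exact Fin.ext (hprim.pow_inj r.2 s.2 hrs)
  have hdet : (Matrix.vandermonde w).det ≠ 0 := Matrix.det_vandermonde_ne_zero_iff.mpr hinj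
  funext i j
  -- The transform of a tube is a Vandermonde matrix applied to it; the nodes are the distinct
  -- powers of the inverse of a primitive root of unity.
  have hmul : (Matrix.vandermonde w).mulVec (fun k => (X i j k : ℂ)) = 0 := by
    funext r
    have := congrFun (congrFun (h r) i) j
    simp only [fftSlice, Matrix.of_apply, Matrix.zero_apply] at this
    rw [Pi.zero_apply, ← this, Matrix.mulVec, dotProduct]
    refine Finset.sum_congr rfl fun k _ => ?_
    simp only [Matrix.vandermonde_apply, hw]
    rw [← Complex.exp_nat_mul, mul_comm]
    congr 2
    ring
  have := Matrix.eq_zero_of_mulVec_eq_zero hdet hmul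
  funext k
  simpa using congrFun this k

/-- The tensor nuclear norm as a seminorm. -/
noncomputable def tnnSeminorm (a b c : ℕ) : Seminorm ℝ (Tensor a b c) :=
  Seminorm.ofSMulLE tnn
    (by
      have h : ∀ r, fftSlice (0 : Tensor a b c) r = 0 := fun r => by ext i j; simp [fftSlice]
      simp [tnn, h, nuclearNorm_zero])
    (fun X Y => by
      rw [tnn, tnn, tnn, ← mul_add, ← Finset.sum_add_distrib]
      refine mul_le_mul_of_nonneg_left (Finset.sum_le_sum fun r _ => ?_) (by positivity)
      rw [fftSlice_add]
      exact nuclearNorm_add_le _ _)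
    (fun s X => by
      rw [tnn, tnn, Real.norm_eq_abs, mul_left_comm,
        Finset.mul_sum Finset.univ (fun r => nuclearNorm (fftSlice X r)) |s|]
      refine mul_le_mul_of_nonneg_left (Finset.sum_le_sum fun r _ => ?_) (by positivity)
      rw [fftSlice_smul]
      exact nuclearNorm_smul_le _ _)

@[simp] theorem tnnSeminorm_apply (X : Tensor a b c) : tnnSeminorm a b c X = tnn X := rfl

theorem eq_zero_of_tnn_eq_zero {X : Tensor a b c} (h : tnn X = 0) : X = 0 := by
  rcases Nat.eq_zero_or_pos c with rfl | hc
  · funext i j k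
    exact k.elim0
  refine eq_zero_of_fftSlice_eq_zero fun r => eq_zero_of_nuclearNorm_eq_zero ?_
  rw [tnn, mul_eq_zero, Finset.sum_eq_zero_iff_of_nonneg (fun _ _ => nuclearNorm_nonneg _)] at h
  exact h.resolve_left (by positivity) r (Finset.mem_univ r)

end RAF

namespace RAF

open Filter Topology RealInnerProductSpace

/-! ### Existence of a minimizer and a Lagrange multiplier. -/

section Multiplier

variable {E V : Type*} [NormedAddCommGroup E] [NormedSpace ℝ E]
  [NormedAddCommGroup V] [InnerProductSpace ℝ V]

/-- The Karush–Kuhn–Tucker conditions for minimizing `f` subject to `K x = b`. -/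
def IsKKT (f : Seminorm ℝ E) (K : E →L[ℝ] V) (b : V) (x : E) (l : V) : Prop :=
  K x = b ∧ ∀ y, f x ≤ f y + ⟪l, K (y - x)⟫

/-- Hahn–Banach: a minimizer of a seminorm on a hyperplane-intersection `K x = b` is supported by
a linear functional that vanishes on the kernel of `K`. -/
theorem exists_supporting_functional (f : Seminorm ℝ E) (K : E →L[ℝ] V) {x : E}
    (hmin : ∀ y, K y = K x → f x ≤ f y) :
    ∃ g : E →ₗ[ℝ] ℝ, g x = f x ∧ (∀ k, K k = 0 → g k = 0) ∧ ∀ y, g y ≤ f y := by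
  -- If `x` lies in the kernel, 0 competes with it, so f x = 0 and the zero functional serves.
  -- Otherwise the functional is prescribed as 0 on the kernel and f x at `x`, then extended.
  by_cases hx : K x = 0
  · refine ⟨0, ?_, fun _ _ => rfl, fun y => apply_nonneg f y⟩
    have := hmin 0 (by simp [hx])
    rw [map_zero] at this
    exact le_antisymm (apply_nonneg f x) this
  let z : E →ₗ.[ℝ] ℝ := ⟨LinearMap.ker K.toLinearMap, 0⟩
  have hxz : x ∉ z.domain := hx
  obtain ⟨g, hg, hgf⟩ := exists_extension_of_le_sublinear (z.supSpanSingleton x (f x) hxz) f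
    (fun c hc y => by rw [map_smul_eq_mul, Real.norm_of_nonneg hc.le]) (map_add_le_add f) (by
      rintro ⟨v, hv⟩
      obtain ⟨k, hk, w, hw, rfl⟩ := Submodule.mem_sup.mp hv
      obtain ⟨c, rfl⟩ := Submodule.mem_span_singleton.mp hw
      rw [LinearPMap.supSpanSingleton_apply_mk z x (f x) hxz k hk c]
      have hk0 : K k = 0 := hk
      have hz0 : z ⟨k, hk⟩ = 0 := rfl
      simp only [hz0, zero_add, RingHom.id_apply, smul_eq_mul]
      -- Domination by `f`: for c ≤ 0 the value c · f x is nonpositive; for c > 0, dividing k + c •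
      -- x by c gives a competitor of `x`.
      rcases le_or_gt c 0 with hc | hc
      · exact (mul_nonpos_of_nonpos_of_nonneg hc (apply_nonneg f x)).trans (apply_nonneg f _)
      · have h1 : k + c • x = c • (c⁻¹ • k + x) := by rw [smul_add, smul_inv_smul₀ hc.ne']
        rw [h1, map_smul_eq_mul, Real.norm_of_nonneg hc.le]
        exact mul_le_mul_of_nonneg_left (hmin _ (by simp [hk0])) hc.le)
  refine ⟨g, ?_, fun k hk => ?_, hgf⟩
  · exact (hg ⟨x, Submodule.mem_sup_right (Submodule.mem_span_singleton_self x)⟩).trans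
      (LinearPMap.supSpanSingleton_apply_self z (f x) hxz)
  · exact (hg ⟨k, Submodule.mem_sup_left hk⟩).trans
      (LinearPMap.supSpanSingleton_apply_mk_of_mem z (f x) hxz hk)

variable [FiniteDimensional ℝ E]

theorem continuous_seminorm (f : Seminorm ℝ E) : Continuous f :=
  continuousOn_univ.mp (f.convexOn.continuousOn isOpen_univ)

/-- The constant is the minimum of `f` on the compact unit sphere. It gives coercivity, both for
existence of minimizers and for boundedness of the iterates. -/
theorem exists_mul_norm_le_seminorm {f : Seminorm ℝ E} (hf : ∀ x, f x = 0 → x = 0) :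
    ∃ c > 0, ∀ x, c * ‖x‖ ≤ f x := by
  rcases subsingleton_or_nontrivial E with h | h
  · exact ⟨1, one_pos, fun x => by simp [Subsingleton.elim x 0]⟩
  obtain ⟨z, hz, hmin⟩ := (isCompact_sphere (0 : E) 1).exists_isMinOn
    (NormedSpace.sphere_nonempty.mpr zero_le_one) (continuous_seminorm f).continuousOn
  have hz1 : ‖z‖ = 1 := by simpa using hz
  have hpos : 0 < f z := lt_of_le_of_ne (apply_nonneg f z) fun h0 => by
    rw [hf z h0.symm] at hz1
    simp at hz1
  refine ⟨f z, hpos, fun x => ?_⟩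
  rcases eq_or_ne x 0 with rfl | hx
  · simp
  have hx' : 0 < ‖x‖ := norm_pos_iff.mpr hx
  have h1 : f z ≤ f (‖x‖⁻¹ • x) := hmin (by simp [norm_smul, hx'.ne'])
  rw [map_smul_eq_mul, norm_inv, norm_norm, inv_mul_eq_div, le_div_iff₀ hx'] at h1
  exact h1

theorem exists_isMinOn_seminorm {f : Seminorm ℝ E} (hf : ∀ x, f x = 0 → x = 0) (K : E →L[ℝ] V)
    {b : V} (hb : ∃ x, K x = b) : ∃ x, K x = b ∧ ∀ y, K y = b → f x ≤ f y := by
  obtain ⟨x₀, hx₀⟩ := hb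
  obtain ⟨c, hc, hcf⟩ := exists_mul_norm_le_seminorm hf
  have hcl : IsClosed {x | K x = b} := isClosed_eq K.continuous continuous_const
  obtain ⟨x, hx, hmin⟩ := (continuous_seminorm f).continuousOn.exists_isMinOn' hcl hx₀ (by
    refine Filter.Eventually.filter_mono inf_le_left ?_
    filter_upwards [(tendsto_norm_cocompact_atTop (E := E)).eventually_ge_atTop (f x₀ / c)]
      with y hy
    rw [div_le_iff₀ hc, mul_comm] at hy
    exact hy.trans (hcf y))
  exact ⟨x, hx, fun y hy => hmin hy⟩

/-- The supporting functional vanishes on the kernel of `K`, so it factors through `K`; the Riesz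
representative of the factor, with opposite sign, is the multiplier. Linear constraints need no
further qualification. -/
theorem exists_isKKT [FiniteDimensional ℝ V] {f : Seminorm ℝ E} (hf : ∀ x, f x = 0 → x = 0)
    (K : E →L[ℝ] V) {b : V} (hb : ∃ x, K x = b) : ∃ x l, IsKKT f K b x l := by
  obtain ⟨x, hx, hmin⟩ := exists_isMinOn_seminorm hf K hb
  obtain ⟨g, hgx, hgk, hgf⟩ := exists_supporting_functional f K (x := x)
    fun y hy => hmin y (hy.trans hx)
  have hg : g ∈ LinearMap.range K.toLinearMap.dualMap := by
    rw [LinearMap.range_dualMap_eq_dualAnnihilator_ker, Submodule.mem_dualAnnihilator]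
    exact fun k hk => hgk k hk
  obtain ⟨ψ, hψ⟩ := hg
  refine ⟨x, -(InnerProductSpace.toDual ℝ V).symm (LinearMap.toContinuousLinearMap ψ), hx,
    fun y => ?_⟩
  have h1 : ψ (K (y - x)) = g y - g x := by
    rw [← map_sub, ← hψ]
    rfl
  rw [inner_neg_left, InnerProductSpace.toDual_symm_apply, LinearMap.coe_toContinuousLinearMap',
    h1, hgx]
  linarith [hgf y]

end Multiplier

/-! ### Monotone sequences up to summable errors. -/

section QuasiFejer

theorem quasiFejer {a d ε : ℕ → ℝ} (ha : ∀ t, 0 ≤ a t) (hd : ∀ t, 0 ≤ d t) (hε : ∀ t, 0 ≤ ε t)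
    (hs : Summable ε) (h : ∀ t, a (t + 1) ^ 2 + d t ≤ a t ^ 2 + 2 * ε t * a (t + 1)) :
    (∃ r, Tendsto a atTop (𝓝 r)) ∧ Tendsto d atTop (𝓝 0) := by
  have hstep : ∀ t, a (t + 1) ≤ a t + 2 * ε t := by
    intro t
    -- Completing the square turns the quadratic recursion into the linear one a(t+1) ≤ a(t) +
    -- 2ε(t).
    have h1 : (a (t + 1) - ε t) ^ 2 ≤ (a t + ε t) ^ 2 := by
      nlinarith [h t, hd t, mul_nonneg (ha t) (hε t)]
    have h2 := abs_le_of_sq_le_sq h1 (add_nonneg (ha t) (hε t))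
    linarith [le_abs_self (a (t + 1) - ε t)]
  have hanti : Antitone fun t => a t - 2 * ∑ i ∈ Finset.range t, ε i := by
    refine antitone_nat_of_succ_le fun t => ?_
    rw [Finset.sum_range_succ]
    linarith [hstep t]
  have hbdd : BddBelow (Set.range fun t => a t - 2 * ∑ i ∈ Finset.range t, ε i) := by
    refine ⟨-(2 * ∑' i, ε i), ?_⟩
    rintro _ ⟨t, rfl⟩
    have := hs.sum_le_tsum (Finset.range t) fun i _ => hε i
    simp only
    linarith [ha t]
  have hconv := (tendsto_atTop_ciInf hanti hbdd).add (hs.hasSum.tendsto_sum_nat.const_mul 2)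
  simp only [sub_add_cancel] at hconv
  refine ⟨⟨_, hconv⟩, ?_⟩
  set r := (⨅ t, (a t - 2 * ∑ i ∈ Finset.range t, ε i)) + 2 * ∑' i, ε i
  have hconv' : Tendsto (fun t => a (t + 1)) atTop (𝓝 r) := hconv.comp (tendsto_add_atTop_nat 1)
  have hup : Tendsto (fun t => a t ^ 2 + 2 * ε t * a (t + 1) - a (t + 1) ^ 2) atTop (𝓝 0) := by
    have := ((hconv.pow 2).add ((hs.tendsto_atTop_zero.const_mul 2).mul hconv')).sub
      (hconv'.pow 2)
    simpa using this
  exact squeeze_zero hd (fun t => by linarith [h t]) hup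

end QuasiFejer

end RAF

namespace RAF

open Filter Topology RealInnerProductSpace

/-! ### Convergence of the inexact proximal augmented Lagrangian method. -/

section ProximalAugmentedLagrangian

variable {E V U₁ U₂ : Type*} [NormedAddCommGroup E] [NormedSpace ℝ E]
  [NormedAddCommGroup V] [InnerProductSpace ℝ V]
  [NormedAddCommGroup U₁] [InnerProductSpace ℝ U₁]
  [NormedAddCommGroup U₂] [InnerProductSpace ℝ U₂]

/-- First-order optimality for the sum of a seminorm and two least-squares terms. -/
theorem variational_inequality_of_isMinOn (f : Seminorm ℝ E) (G₁ : E →L[ℝ] U₁) (G₂ : E →L[ℝ] U₂)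
    (a₁ : U₁) (a₂ : U₂) (μ₁ μ₂ : ℝ) {x : E}
    (hx : ∀ y, μ₁ / 2 * ‖G₁ x + a₁‖ ^ 2 + μ₂ / 2 * ‖G₂ x + a₂‖ ^ 2 + f x ≤
      μ₁ / 2 * ‖G₁ y + a₁‖ ^ 2 + μ₂ / 2 * ‖G₂ y + a₂‖ ^ 2 + f y) (y : E) :
    f x ≤ f y + μ₁ * ⟪G₁ x + a₁, G₁ (y - x)⟫ + μ₂ * ⟪G₂ x + a₂, G₂ (y - x)⟫ := by
  set c := μ₁ / 2 * ‖G₁ (y - x)‖ ^ 2 + μ₂ / 2 * ‖G₂ (y - x)‖ ^ 2 with hc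
  set d := f y - f x + μ₁ * ⟪G₁ x + a₁, G₁ (y - x)⟫ + μ₂ * ⟪G₂ x + a₂, G₂ (y - x)⟫ with hd
  have key : ∀ s : ℝ, 0 < s → s ≤ 1 → 0 ≤ d + s * c := by
    intro s hs hs1
    have h1 := hx (x + s • (y - x))
    have h2 : f (x + s • (y - x)) ≤ (1 - s) * f x + s * f y := by
      have h3 : x + s • (y - x) = (1 - s) • x + s • y := by module
      rw [h3]
      refine (map_add_le_add f _ _).trans (le_of_eq ?_)
      rw [map_smul_eq_mul, map_smul_eq_mul, Real.norm_of_nonneg hs.le,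
        Real.norm_of_nonneg (sub_nonneg.mpr hs1)]
    have e₁ : G₁ (x + s • (y - x)) + a₁ = (G₁ x + a₁) + s • G₁ (y - x) := by
      rw [map_add, map_smul]; abel
    have e₂ : G₂ (x + s • (y - x)) + a₂ = (G₂ x + a₂) + s • G₂ (y - x) := by
      rw [map_add, map_smul]; abel
    rw [e₁, e₂, norm_add_sq_real (G₁ x + a₁), norm_add_sq_real (G₂ x + a₂), inner_smul_right, inner_smul_right,
      norm_smul, norm_smul, Real.norm_of_nonneg hs.le] at h1
    -- Comparison with the point x + s(y − x) of the segment; dividing by `s` and letting s → 0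
    -- leaves the first-order term `d`.
    have h4 : 0 ≤ s * (d + s * c) := by
      rw [hc, hd]
      linear_combination h1 + h2
    exact nonneg_of_mul_nonneg_right h4 hs
  have hlim : Tendsto (fun s : ℝ => d + s * c) (𝓝[>] 0) (𝓝 d) := by
    have : Tendsto (fun s : ℝ => d + s * c) (𝓝 0) (𝓝 (d + 0 * c)) :=
      (continuous_const.add (continuous_id.mul continuous_const)).tendsto 0
    rw [zero_mul, add_zero] at this
    exact this.mono_left nhdsWithin_le_nhds
  have hd0 : 0 ≤ d := by
    refine ge_of_tendsto hlim ?_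
    filter_upwards [Ioc_mem_nhdsGT (zero_lt_one (α := ℝ))] with s hs
    exact key s hs.1 hs.2
  linarith

/-- The proximal augmented Lagrangian method for minimizing `f` subject to `K x = b`, with
semi-proximal terms given by `W₁`, `W₂` and summable errors `e`; the minimization in each step is
expressed by its variational inequality. -/
structure IsProxAugLagrangian (f : Seminorm ℝ E) (K : E →L[ℝ] V) (b : V) (W₁ : E →L[ℝ] U₁)
    (W₂ : E →L[ℝ] U₂) (μ₁ μ₂ ρ : ℝ) (x : ℕ → E) (l : ℕ → V) (e : ℕ → U₂) : Prop where
  step : ∀ t y, f (x (t + 1)) ≤ f y + ⟪l t + μ₁ • (K (x (t + 1)) - b), K (y - x (t + 1))⟫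
    + μ₁ * ⟪W₁ (x (t + 1) - x t), W₁ (y - x (t + 1))⟫
    + μ₂ * ⟪W₂ (x (t + 1) - x t) - e t, W₂ (y - x (t + 1))⟫
  mult : ∀ t, l (t + 1) = l t + (ρ * μ₁) • (K (x (t + 1)) - b)
  summable : Summable fun t => ‖e t‖

namespace IsProxAugLagrangian

variable {f : Seminorm ℝ E} {K : E →L[ℝ] V} {b : V} {W₁ : E →L[ℝ] U₁} {W₂ : E →L[ℝ] U₂}
  {μ₁ μ₂ ρ : ℝ} {x : ℕ → E} {l : ℕ → V} {e : ℕ → U₂}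

/-- The squared distance of `(x, l)` to `(xs, ls)` that decreases along the iteration. -/
noncomputable def distSq (W₁ : E →L[ℝ] U₁) (W₂ : E →L[ℝ] U₂) (μ₁ μ₂ ρ : ℝ) (xs : E) (ls : V)
    (x : E) (l : V) : ℝ :=
  (ρ * μ₁)⁻¹ * ‖l - ls‖ ^ 2 + μ₁ * ‖W₁ (x - xs)‖ ^ 2 + μ₂ * ‖W₂ (x - xs)‖ ^ 2

/-- The decrease of the squared distance in one step. -/
noncomputable def decrease (K : E →L[ℝ] V) (b : V) (W₁ : E →L[ℝ] U₁) (W₂ : E →L[ℝ] U₂)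
    (μ₁ μ₂ ρ : ℝ) (x y : E) : ℝ :=
  (2 - ρ) * μ₁ * ‖K y - b‖ ^ 2 + μ₁ * ‖W₁ (y - x)‖ ^ 2 + μ₂ * ‖W₂ (y - x)‖ ^ 2

/-- Adding the step inequality at `xs` to the saddle inequality at the new iterate cancels the
values of `f`; the inner products that remain are differences of squares. -/
theorem distSq_add_decrease_le (h : IsProxAugLagrangian f K b W₁ W₂ μ₁ μ₂ ρ x l e)
    (hμ₁ : 0 < μ₁) (hρ : 0 < ρ) {xs : E} {ls : V} (hs : IsKKT f K b xs ls) (t : ℕ) :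
    distSq W₁ W₂ μ₁ μ₂ ρ xs ls (x (t + 1)) (l (t + 1)) +
      decrease K b W₁ W₂ μ₁ μ₂ ρ (x t) (x (t + 1)) ≤
      distSq W₁ W₂ μ₁ μ₂ ρ xs ls (x t) (l t) + 2 * μ₂ * ⟪e t, W₂ (x (t + 1) - xs)⟫ := by
  have h1 := h.step t xs
  have h2 := hs.2 (x (t + 1))
  unfold distSq decrease
  set r := K (x (t + 1)) - b with hr
  have hK : K (x (t + 1) - xs) = r := by rw [map_sub, hs.1]
  have hK' : K (xs - x (t + 1)) = -r := by rw [← neg_sub, map_neg, hK]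
  have hl : l (t + 1) - ls = (l t - ls) + (ρ * μ₁) • r := by rw [h.mult]; abel
  have hW : ∀ z w : E, z - xs = (z - w) + (w - xs) := fun z w => by abel
  have hn₁ : W₁ (xs - x (t + 1)) = -(W₁ (x (t + 1) - x t) + W₁ (x t - xs)) := by
    rw [← map_add, ← map_neg]; congr 1; abel
  have hn₂ : W₂ (xs - x (t + 1)) = -(W₂ (x (t + 1) - x t) + W₂ (x t - xs)) := by
    rw [← map_add, ← map_neg]; congr 1; abel
  rw [hl, hW (x (t + 1)) (x t), map_add, map_add, norm_add_sq_real, norm_add_sq_real,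
    norm_add_sq_real, norm_smul, inner_smul_right, Real.norm_of_nonneg (by positivity)]
  rw [hK] at h2
  rw [hK', hn₁, hn₂] at h1
  simp only [inner_add_left, inner_sub_left, inner_neg_right, inner_add_right, inner_smul_left,
    real_inner_self_eq_norm_sq, conj_trivial] at h1 ⊢
  -- The weight (ρμ₁)⁻¹ matches the multiplier step. It leaves ρμ₁‖r‖², which against 2μ₁‖r‖² from
  -- the penalty gives the factor (2 − ρ)μ₁ of the decrease.
  have hcancel : (ρ * μ₁)⁻¹ * (2 * (ρ * μ₁ * (⟪l t, r⟫ - ⟪ls, r⟫)) + (ρ * μ₁ * ‖r‖) ^ 2) =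
      2 * (⟪l t, r⟫ - ⟪ls, r⟫) + ρ * μ₁ * ‖r‖ ^ 2 := by
    field_simp
  linear_combination 2 * h1 + 2 * h2 + hcancel

theorem tendsto_distSq (h : IsProxAugLagrangian f K b W₁ W₂ μ₁ μ₂ ρ x l e)
    (hμ₁ : 0 < μ₁) (hμ₂ : 0 < μ₂) (hρ : 0 < ρ) (hρ2 : ρ < 2) {xs : E} {ls : V}
    (hs : IsKKT f K b xs ls) :
    (∃ r, Tendsto (fun t => distSq W₁ W₂ μ₁ μ₂ ρ xs ls (x t) (l t)) atTop (𝓝 r)) ∧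
      Tendsto (fun t => decrease K b W₁ W₂ μ₁ μ₂ ρ (x t) (x (t + 1))) atTop (𝓝 0) := by
  have hnn : ∀ t, 0 ≤ distSq W₁ W₂ μ₁ μ₂ ρ xs ls (x t) (l t) := fun t => by
    unfold distSq
    positivity
  have hq := quasiFejer (a := fun t => √(distSq W₁ W₂ μ₁ μ₂ ρ xs ls (x t) (l t)))
    (d := fun t => decrease K b W₁ W₂ μ₁ μ₂ ρ (x t) (x (t + 1)))
    (ε := fun t => √μ₂ * ‖e t‖) (fun t => Real.sqrt_nonneg _)
    (fun t => by
      have := sub_pos.mpr hρ2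
      unfold decrease
      positivity)
    (fun t => by positivity) (h.summable.mul_left _) (fun t => by
      simp only [Real.sq_sqrt (hnn _)]
      refine (h.distSq_add_decrease_le hμ₁ hρ hs t).trans (add_le_add_right ?_ _)
      -- The error pairs only with the `W₂`-part, which the distance itself controls; hence the
      -- choice of √μ₂‖e‖ as perturbation.
      have h1 : √μ₂ * ‖W₂ (x (t + 1) - xs)‖ ≤
          √(distSq W₁ W₂ μ₁ μ₂ ρ xs ls (x (t + 1)) (l (t + 1))) := by
        refine Real.le_sqrt_of_sq_le ?_
        rw [mul_pow, Real.sq_sqrt hμ₂.le, distSq]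
        exact le_add_of_nonneg_left (by positivity)
      calc 2 * μ₂ * ⟪e t, W₂ (x (t + 1) - xs)⟫
          ≤ 2 * μ₂ * (‖e t‖ * ‖W₂ (x (t + 1) - xs)‖) := by
            gcongr
            exact real_inner_le_norm _ _
        _ = 2 * (√μ₂ * ‖e t‖) * (√μ₂ * ‖W₂ (x (t + 1) - xs)‖) := by
            linear_combination (-2 * ‖e t‖ * ‖W₂ (x (t + 1) - xs)‖) * Real.mul_self_sqrt hμ₂.le
        _ ≤ _ := by gcongr)
  obtain ⟨⟨r, hr⟩, hd⟩ := hq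
  refine ⟨⟨r ^ 2, ?_⟩, hd⟩
  simpa only [Real.sq_sqrt (hnn _)] using hr.pow 2

theorem tendsto_zero_of_mul_sq_le {G : Type*} [NormedAddCommGroup G] {g : ℕ → G} {d : ℕ → ℝ}
    {c : ℝ} (hc : 0 < c) (hd : Tendsto d atTop (𝓝 0)) (hg : ∀ t, c * ‖g t‖ ^ 2 ≤ d t) :
    Tendsto g atTop (𝓝 0) := by
  have h1 : Tendsto (fun t => ‖g t‖ ^ 2) atTop (𝓝 0) := by
    refine squeeze_zero (fun t => by positivity) (fun t => ?_) (by simpa using hd.const_mul c⁻¹)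
    rw [inv_mul_eq_div, le_div_iff₀ hc, mul_comm]
    exact hg t
  rw [tendsto_zero_iff_norm_tendsto_zero]
  simpa [Real.sqrt_sq] using h1.sqrt

theorem exists_norm_le_of_mul_sq_le {G : Type*} [NormedAddCommGroup G] {g : ℕ → G} {d : ℕ → ℝ}
    {c r : ℝ} (hc : 0 < c) (hd : Tendsto d atTop (𝓝 r)) (hg : ∀ t, c * ‖g t‖ ^ 2 ≤ d t) :
    ∃ B, ∀ t, ‖g t‖ ≤ B := by
  obtain ⟨B, hB⟩ := hd.bddAbove_range
  refine ⟨√(B / c), fun t => Real.le_sqrt_of_sq_le ?_⟩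
  rw [le_div_iff₀ hc, mul_comm]
  exact (hg t).trans (hB ⟨t, rfl⟩)

theorem map_eq_of_tendsto_map_sub {G : Type*} [NormedAddCommGroup G] [NormedSpace ℝ G]
    (W : E →L[ℝ] G) {xs x' : E} (hW : Tendsto (fun t => W (x t - xs)) atTop (𝓝 0)) {ψ : ℕ → ℕ}
    (hψ : Tendsto ψ atTop atTop) (hx : Tendsto (fun k => x (ψ k)) atTop (𝓝 x')) :
    W xs = W x' := by
  have h1 : Tendsto (fun k => W (x (ψ k) - xs)) atTop (𝓝 (W (x' - xs))) :=
    (W.continuous.tendsto _).comp (hx.sub_const xs)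
  have h2 := tendsto_nhds_unique h1 (hW.comp hψ)
  rw [map_sub, sub_eq_zero] at h2
  exact h2.symm

variable [FiniteDimensional ℝ E] [FiniteDimensional ℝ V]

/-- The iterates converge to a Karush–Kuhn–Tucker pair, provided that the primal part of such a
pair is determined by its images under `W₁` and `W₂`. -/
theorem exists_tendsto (h : IsProxAugLagrangian f K b W₁ W₂ μ₁ μ₂ ρ x l e)
    (hμ₁ : 0 < μ₁) (hμ₂ : 0 < μ₂) (hρ : 0 < ρ) (hρ2 : ρ < 2) (hf : ∀ x, f x = 0 → x = 0)
    (hb : ∃ x, K x = b)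
    (huniq : ∀ x x' l, IsKKT f K b x l → IsKKT f K b x' l → W₁ x = W₁ x' → W₂ x = W₂ x' → x = x') :
    ∃ xs ls, IsKKT f K b xs ls ∧ Tendsto x atTop (𝓝 xs) ∧ Tendsto l atTop (𝓝 ls) := by
  obtain ⟨x₀, l₀, h₀⟩ := exists_isKKT hf K hb
  obtain ⟨⟨r₀, hr₀⟩, hdec⟩ := h.tendsto_distSq hμ₁ hμ₂ hρ hρ2 h₀
  have hρ' : 0 < 2 - ρ := sub_pos.mpr hρ2
  have hres : Tendsto (fun t => K (x (t + 1)) - b) atTop (𝓝 0) :=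
    tendsto_zero_of_mul_sq_le (c := (2 - ρ) * μ₁) (by positivity) hdec fun t => by
      unfold decrease
      linarith [show 0 ≤ μ₁ * ‖W₁ (x (t + 1) - x t)‖ ^ 2 by positivity,
        show 0 ≤ μ₂ * ‖W₂ (x (t + 1) - x t)‖ ^ 2 by positivity]
  have hd₁ : Tendsto (fun t => W₁ (x (t + 1) - x t)) atTop (𝓝 0) :=
    tendsto_zero_of_mul_sq_le hμ₁ hdec fun t => by
      unfold decrease
      linarith [show 0 ≤ (2 - ρ) * μ₁ * ‖K (x (t + 1)) - b‖ ^ 2 by positivity,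
        show 0 ≤ μ₂ * ‖W₂ (x (t + 1) - x t)‖ ^ 2 by positivity]
  have hd₂ : Tendsto (fun t => W₂ (x (t + 1) - x t)) atTop (𝓝 0) :=
    tendsto_zero_of_mul_sq_le hμ₂ hdec fun t => by
      unfold decrease
      linarith [show 0 ≤ (2 - ρ) * μ₁ * ‖K (x (t + 1)) - b‖ ^ 2 by positivity,
        show 0 ≤ μ₁ * ‖W₁ (x (t + 1) - x t)‖ ^ 2 by positivity]
  have he : Tendsto e atTop (𝓝 0) :=
    tendsto_zero_iff_norm_tendsto_zero.mpr h.summable.tendsto_atTop_zero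
  have hc : 0 < (ρ * μ₁)⁻¹ := by positivity
  obtain ⟨Bl, hBl⟩ := exists_norm_le_of_mul_sq_le (g := fun t => l t - l₀) hc hr₀ fun t => by
    unfold distSq
    linarith [show 0 ≤ μ₁ * ‖W₁ (x t - x₀)‖ ^ 2 by positivity,
      show 0 ≤ μ₂ * ‖W₂ (x t - x₀)‖ ^ 2 by positivity]
  obtain ⟨B₁, hB₁⟩ := exists_norm_le_of_mul_sq_le (g := fun t => W₁ (x t - x₀)) hμ₁ hr₀ fun t => by
    unfold distSq
    linarith [show 0 ≤ (ρ * μ₁)⁻¹ * ‖l t - l₀‖ ^ 2 by positivity,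
      show 0 ≤ μ₂ * ‖W₂ (x t - x₀)‖ ^ 2 by positivity]
  obtain ⟨B₂, hB₂⟩ := exists_norm_le_of_mul_sq_le (g := fun t => W₂ (x t - x₀)) hμ₂ hr₀ fun t => by
    unfold distSq
    linarith [show 0 ≤ (ρ * μ₁)⁻¹ * ‖l t - l₀‖ ^ 2 by positivity,
      show 0 ≤ μ₁ * ‖W₁ (x t - x₀)‖ ^ 2 by positivity]
  -- the iterates are bounded
  obtain ⟨Bx, hBx⟩ : ∃ B, ∀ t, ‖x (t + 1)‖ ≤ B := by
    obtain ⟨c, hc0, hcf⟩ := exists_mul_norm_le_seminorm hf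
    obtain ⟨Br, hBr⟩ := hres.norm.bddAbove_range
    obtain ⟨D₁, hD₁⟩ := hd₁.norm.bddAbove_range
    obtain ⟨D₂, hD₂⟩ := (hd₂.sub he).norm.bddAbove_range
    refine ⟨(f x₀ + (Bl + ‖l₀‖ + μ₁ * Br) * Br + μ₁ * (D₁ * B₁) + μ₂ * (D₂ * B₂)) / c,
      fun t => ?_⟩
    rw [le_div_iff₀ hc0, mul_comm]
    have hr : ‖K (x (t + 1)) - b‖ ≤ Br := hBr ⟨t, rfl⟩
    have hlt : ‖l t + μ₁ • (K (x (t + 1)) - b)‖ ≤ Bl + ‖l₀‖ + μ₁ * Br := by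
      refine (norm_add_le _ _).trans (add_le_add ?_ ?_)
      · rw [← sub_add_cancel (l t) l₀]
        exact (norm_add_le _ _).trans (add_le_add_left (hBl t) _)
      · rw [norm_smul, Real.norm_of_nonneg hμ₁.le]
        exact mul_le_mul_of_nonneg_left hr hμ₁.le
    have hK : ‖K (x₀ - x (t + 1))‖ ≤ Br := by rwa [map_sub, h₀.1, norm_sub_rev]
    have hW₁ : ‖W₁ (x₀ - x (t + 1))‖ ≤ B₁ := by
      rw [← neg_sub, map_neg, norm_neg]; exact hB₁ (t + 1)
    have hW₂ : ‖W₂ (x₀ - x (t + 1))‖ ≤ B₂ := by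
      rw [← neg_sub, map_neg, norm_neg]; exact hB₂ (t + 1)
    refine (hcf _).trans ((h.step t x₀).trans ?_)
    refine add_le_add (add_le_add (add_le_add_right ?_ _) ?_) ?_
    · exact (real_inner_le_norm _ _).trans
        (mul_le_mul hlt hK (norm_nonneg _) ((norm_nonneg _).trans hlt))
    · have hD : ‖W₁ (x (t + 1) - x t)‖ ≤ D₁ := hD₁ ⟨t, rfl⟩
      exact mul_le_mul_of_nonneg_left ((real_inner_le_norm _ _).trans
        (mul_le_mul hD hW₁ (norm_nonneg _) ((norm_nonneg _).trans hD))) hμ₁.le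
    · have hD : ‖W₂ (x (t + 1) - x t) - e t‖ ≤ D₂ := hD₂ ⟨t, rfl⟩
      exact mul_le_mul_of_nonneg_left ((real_inner_le_norm _ _).trans
        (mul_le_mul hD hW₂ (norm_nonneg _) ((norm_nonneg _).trans hD))) hμ₂.le
  -- cluster points are Karush–Kuhn–Tucker pairs
  have hcluster : ∀ (ψ : ℕ → ℕ) (xs : E) (ls : V), Tendsto ψ atTop atTop →
      Tendsto (fun k => x (ψ k + 1)) atTop (𝓝 xs) → Tendsto (fun k => l (ψ k + 1)) atTop (𝓝 ls) →
      IsKKT f K b xs ls := by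
    intro ψ xs ls hψ hx hl
    have hKx := (K.continuous.tendsto xs).comp hx
    have hresψ := hres.comp hψ
    refine ⟨sub_eq_zero.mp (tendsto_nhds_unique (hKx.sub_const b) hresψ), fun y => ?_⟩
    -- The step uses the old multiplier. It differs from the new one by a multiple of the residual,
    -- which tends to 0.
    have hl' : Tendsto (fun k => l (ψ k) + μ₁ • (K (x (ψ k + 1)) - b)) atTop (𝓝 ls) := by
      have h1 : Tendsto (fun k => l (ψ k + 1) + (μ₁ - ρ * μ₁) • (K (x (ψ k + 1)) - b)) atTop
          (𝓝 (ls + (μ₁ - ρ * μ₁) • (0 : V))) := hl.add (hresψ.const_smul _)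
      rw [smul_zero, add_zero] at h1
      refine h1.congr fun k => ?_
      rw [h.mult]
      module
    have hyx : Tendsto (fun k => y - x (ψ k + 1)) atTop (𝓝 (y - xs)) := hx.const_sub y
    have hK : Tendsto (fun k => K (y - x (ψ k + 1))) atTop (𝓝 (K (y - xs))) :=
      (K.continuous.tendsto _).comp hyx
    have hW₁ : Tendsto (fun k => W₁ (y - x (ψ k + 1))) atTop (𝓝 (W₁ (y - xs))) :=
      (W₁.continuous.tendsto _).comp hyx
    have hW₂ : Tendsto (fun k => W₂ (y - x (ψ k + 1))) atTop (𝓝 (W₂ (y - xs))) :=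
      (W₂.continuous.tendsto _).comp hyx
    have hrhs := (((hl'.inner hK).const_add (f y)).add
      (((hd₁.comp hψ).inner hW₁).const_mul μ₁)).add
      ((((hd₂.sub he).comp hψ).inner hW₂).const_mul μ₂)
    simp only [sub_zero, inner_zero_left, mul_zero, add_zero] at hrhs
    exact le_of_tendsto_of_tendsto (((continuous_seminorm f).tendsto xs).comp hx) hrhs
      (Eventually.of_forall fun k => h.step (ψ k) y)
  obtain ⟨⟨xs, ls⟩, -, ψ, hψ, hlim⟩ := tendsto_subseq_of_bounded
    (Metric.isBounded_closedBall (x := (0 : E × V)) (r := max Bx (Bl + ‖l₀‖)))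
    (x := fun t => (x (t + 1), l (t + 1))) (fun t => by
      rw [mem_closedBall_zero_iff, Prod.norm_def]
      refine max_le_max (hBx t) ?_
      rw [← sub_add_cancel (l (t + 1)) l₀]
      exact (norm_add_le _ _).trans (add_le_add_left (hBl (t + 1)) _))
  have hxψ : Tendsto (fun k => x (ψ k + 1)) atTop (𝓝 xs) := (continuous_fst.tendsto _).comp hlim
  have hlψ : Tendsto (fun k => l (ψ k + 1)) atTop (𝓝 ls) := (continuous_snd.tendsto _).comp hlim
  have hs := hcluster ψ xs ls hψ.tendsto_atTop hxψ hlψ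
  -- The distance to the cluster point converges, and along the subsequence its limit is 0.
  have hdist : Tendsto (fun t => distSq W₁ W₂ μ₁ μ₂ ρ xs ls (x t) (l t)) atTop (𝓝 0) := by
    obtain ⟨⟨r, hr⟩, -⟩ := h.tendsto_distSq hμ₁ hμ₂ hρ hρ2 hs
    have h1 := hr.comp ((tendsto_add_atTop_nat 1).comp hψ.tendsto_atTop)
    have hcont : Continuous fun z : E × V => distSq W₁ W₂ μ₁ μ₂ ρ xs ls z.1 z.2 := by
      unfold distSq
      fun_prop
    have h2 := (hcont.tendsto (xs, ls)).comp hlim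
    have h3 : distSq W₁ W₂ μ₁ μ₂ ρ xs ls xs ls = 0 := by simp [distSq]
    rw [h3] at h2
    rwa [tendsto_nhds_unique h1 h2] at hr
  have hl : Tendsto l atTop (𝓝 ls) := by
    rw [← tendsto_sub_nhds_zero_iff]
    refine tendsto_zero_of_mul_sq_le hc hdist fun t => ?_
    unfold distSq
    linarith [show 0 ≤ μ₁ * ‖W₁ (x t - xs)‖ ^ 2 by positivity,
      show 0 ≤ μ₂ * ‖W₂ (x t - xs)‖ ^ 2 by positivity]
  have hW₁ : Tendsto (fun t => W₁ (x t - xs)) atTop (𝓝 0) := by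
    refine tendsto_zero_of_mul_sq_le hμ₁ hdist fun t => ?_
    unfold distSq
    linarith [show 0 ≤ (ρ * μ₁)⁻¹ * ‖l t - ls‖ ^ 2 by positivity,
      show 0 ≤ μ₂ * ‖W₂ (x t - xs)‖ ^ 2 by positivity]
  have hW₂ : Tendsto (fun t => W₂ (x t - xs)) atTop (𝓝 0) := by
    refine tendsto_zero_of_mul_sq_le hμ₂ hdist fun t => ?_
    unfold distSq
    linarith [show 0 ≤ (ρ * μ₁)⁻¹ * ‖l t - ls‖ ^ 2 by positivity,
      show 0 ≤ μ₁ * ‖W₁ (x t - xs)‖ ^ 2 by positivity]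
  refine ⟨xs, ls, hs, ?_, hl⟩
  rw [← tendsto_add_atTop_iff_nat 1]
  -- The distance controls only the images of `x` under `W₁` and `W₂`. Every further cluster point
  -- shares these images and the multiplier `ls`, so `huniq` identifies it with `xs`.
  refine tendsto_of_subseq_tendsto fun ns hns => ?_
  obtain ⟨x', -, ms, hms, hx'⟩ := tendsto_subseq_of_bounded
    (Metric.isBounded_closedBall (x := (0 : E)) (r := Bx)) (x := fun k => x (ns k + 1))
    (fun k => mem_closedBall_zero_iff.mpr (hBx (ns k)))
  have hnm : Tendsto (fun k => ns (ms k)) atTop atTop := hns.comp hms.tendsto_atTop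
  have hnm1 := (tendsto_add_atTop_nat 1).comp hnm
  have hK' := hcluster (fun k => ns (ms k)) x' ls hnm hx' (hl.comp hnm1)
  have h1 : W₁ xs = W₁ x' := map_eq_of_tendsto_map_sub W₁ hW₁ hnm1 hx'
  have h2 : W₂ xs = W₂ x' := map_eq_of_tendsto_map_sub W₂ hW₂ hnm1 hx'
  rw [huniq xs x' ls hs hK' h1 h2]
  exact ⟨ms, hx'⟩

end IsProxAugLagrangian

end ProximalAugmentedLagrangian

end RAF

namespace RAF

open Filter Topology RealInnerProductSpace

/-! ### Tensors as Euclidean vectors. -/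

section Vectorization

variable {a b c : ℕ}

/-- Tensors as Euclidean vectors. -/
noncomputable def vec (a b c : ℕ) :
    Tensor a b c ≃L[ℝ] EuclideanSpace ℝ (Fin a × Fin b × Fin c) :=
  LinearEquiv.toContinuousLinearEquiv
    { toFun := fun X => WithLp.toLp 2 fun q => X q.1 q.2.1 q.2.2
      map_add' := fun _ _ => rfl
      map_smul' := fun _ _ => rfl
      invFun := fun v i j k => v (i, j, k)
      left_inv := fun _ => rfl
      right_inv := fun _ => rfl }

theorem inner_vec (X Y : Tensor a b c) : ⟪vec a b c X, vec a b c Y⟫ = tinner X Y := by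
  simp only [tinner, PiLp.inner_apply, Fintype.sum_prod_type]
  exact Finset.sum_congr rfl fun i _ => Finset.sum_congr rfl fun j _ =>
    Finset.sum_congr rfl fun k _ => mul_comm _ _

theorem norm_vec_sq (X : Tensor a b c) : ‖vec a b c X‖ ^ 2 = frobSq X := by
  rw [← real_inner_self_eq_norm_sq, inner_vec]
  simp only [tinner, frobSq, sq]

theorem unfold3_add (X Y : Tensor a b c) : unfold3 (X + Y) = unfold3 X + unfold3 Y := rfl

theorem unfold3_smul (r : ℝ) (X : Tensor a b c) : unfold3 (r • X) = r • unfold3 X := rfl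

theorem unfold3_fold3 (X : Matrix (Fin c) (Fin a × Fin b) ℝ) : unfold3 (fold3 X) = X := rfl

theorem unfold3_injective : Function.Injective (unfold3 : Tensor a b c → _) :=
  fun X Y h => by
    funext i j k
    exact congrFun (congrFun h k) (i, j)

theorem continuous_unfold3 :
    Continuous (unfold3 : Tensor a b c → Matrix (Fin c) (Fin a × Fin b) ℝ) := by
  refine continuous_matrix fun k q => ?_
  change Continuous fun X : Tensor a b c => X q.1 q.2 k
  fun_prop

theorem continuous_fold3 :
    Continuous (fold3 : Matrix (Fin c) (Fin a × Fin b) ℝ → Tensor a b c) :=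
  continuous_pi fun i => continuous_pi fun j => continuous_pi fun k =>
    continuous_id.matrix_elem k (i, j)

end Vectorization

/-! ### The degradation operators, the projection onto the range of 𝒥, and the closed-form updates.
-/

namespace Data

variable {M N H m n h L p : ℕ} (P : Data M N H m n h L p)

/-- `X ↦ ℋ_spa(X ×₃ D)` as a linear map. -/
def spaMap : Tensor M N L →ₗ[ℝ] Tensor m n H where
  toFun X := P.Hspa (mode3 X P.D)
  map_add' X Y := unfold3_injective <| by
    simp [Hspa, mode3, unfold3_add, unfold3_fold3, Matrix.mul_add, Matrix.add_mul]
  map_smul' r X := unfold3_injective <| by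
    simp [Hspa, mode3, unfold3_smul, unfold3_fold3]

/-- `X ↦ ℋ_spec(X ×₃ D)` as a linear map. -/
def specMap : Tensor M N L →ₗ[ℝ] Tensor M N h where
  toFun X := P.Hspec (mode3 X P.D)
  map_add' X Y := unfold3_injective <| by
    simp [Hspec, mode3, unfold3_add, unfold3_fold3, Matrix.mul_add]
  map_smul' r X := unfold3_injective <| by
    simp [Hspec, mode3, unfold3_smul, unfold3_fold3]

theorem res1_eq (X : Tensor M N L) (Δτ : Matrix (Fin p) (Fin H) ℝ) :
    P.res1 X Δτ = P.spaMap X - (P.warped + P.J Δτ) := rfl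

theorem res2_eq (X : Tensor M N L) (A : Matrix (Fin h) (Fin h) ℝ) (C : Tensor M N h) :
    P.res2 X A C = P.specMap X - (mode3 P.Z A + C) := rfl

/-- The orthogonal projection onto the range of `𝒥`. -/
noncomputable def projJ : Tensor m n H →ₗ[ℝ] Tensor m n H where
  toFun v i j b := ((P.jac b * pinv (P.jac b)).mulVec fun q => v q.1 q.2 b) (i, j)
  map_add' u v := by
    funext i j b
    exact congrFun (Matrix.mulVec_add (P.jac b * pinv (P.jac b)) (fun q => u q.1 q.2 b)
      fun q => v q.1 q.2 b) (i, j)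
  map_smul' r v := by
    funext i j b
    exact congrFun (Matrix.mulVec_smul (P.jac b * pinv (P.jac b)) r fun q => v q.1 q.2 b) (i, j)

theorem projJ_apply (v : Tensor m n H) (i : Fin m) (j : Fin n) (b : Fin H) :
    P.projJ v i j b = ((P.jac b * pinv (P.jac b)).mulVec fun q => v q.1 q.2 b) (i, j) := rfl

theorem sum_mul_mul_single_apply {α β : Type*} [Fintype β] (Δ : Matrix β (Fin H) ℝ)
    (k : α) (b : Fin H) (F : Fin H → Matrix α β ℝ) :
    (∑ b' : Fin H, F b' * Δ * Matrix.single b' b' (1 : ℝ)) k b = (F b * Δ) k b := by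
  rw [Matrix.sum_apply, Finset.sum_eq_single b]
  · simp
  · intro b' _ hb
    exact Matrix.mul_single_apply_of_ne _ _ _ _ _ hb.symm _
  · simp

theorem J_apply (Δτ : Matrix (Fin p) (Fin H) ℝ) (i : Fin m) (j : Fin n) (b : Fin H) :
    P.J Δτ i j b = (P.jac b).mulVec (fun k => Δτ k b) (i, j) :=
  sum_mul_mul_single_apply Δτ (i, j) b P.jac

theorem J_stepτ (μ₁ : ℝ) (X : Tensor M N L) (O₁ : Tensor m n H) :
    P.J (P.stepτ μ₁ X O₁) = P.projJ (P.spaMap X + μ₁⁻¹ • O₁ - P.warped) := by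
  funext i j b
  rw [J_apply, projJ_apply, ← Matrix.mulVec_mulVec]
  congr 2
  funext k
  exact sum_mul_mul_single_apply _ k b fun b => pinv (P.jac b)

theorem projJ_J (Δτ : Matrix (Fin p) (Fin H) ℝ) : P.projJ (P.J Δτ) = P.J Δτ := by
  funext i j b
  simp only [projJ_apply, J_apply]
  rw [Matrix.mulVec_mulVec, (pinv_penrose (P.jac b)).1]

theorem projJ_projJ (v : Tensor m n H) : P.projJ (P.projJ v) = P.projJ v := by
  funext i j b
  simp only [projJ_apply]
  rw [Matrix.mulVec_mulVec, ← Matrix.mul_assoc, (pinv_penrose (P.jac b)).1]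

theorem inner_vec_eq_sum_dotProduct (u v : Tensor m n H) :
    ⟪vec m n H u, vec m n H v⟫ =
      ∑ b, (fun q : Fin m × Fin n => u q.1 q.2 b) ⬝ᵥ fun q => v q.1 q.2 b := by
  rw [inner_vec, tinner]
  simp only [dotProduct, Fintype.sum_prod_type]
  rw [Finset.sum_comm (s := (Finset.univ : Finset (Fin H)))]
  exact Finset.sum_congr rfl fun i _ => Finset.sum_comm

theorem inner_vec_projJ (u v : Tensor m n H) :
    ⟪vec m n H (P.projJ u), vec m n H v⟫ = ⟪vec m n H u, vec m n H (P.projJ v)⟫ := by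
  simp only [inner_vec_eq_sum_dotProduct, projJ_apply]
  refine Finset.sum_congr rfl fun b _ => ?_
  have h1 := (pinv_penrose (P.jac b)).2.2.1
  set G := P.jac b * pinv (P.jac b)
  change G.mulVec _ ⬝ᵥ _ = _ ⬝ᵥ G.mulVec _
  rw [Matrix.dotProduct_mulVec, ← Matrix.mulVec_transpose, h1]

/-- Splits s − Πs' orthogonally as (s − Πs) + Π(s − s'). With s, s' belonging to the new and the old
ℒ, the first part is the penalty of the reduced problem and the second its proximal term. -/
theorem inner_vec_sub_projJ (s s' w : Tensor m n H) :
    ⟪vec m n H (s - P.projJ s'), vec m n H w⟫ =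
      ⟪vec m n H (s - P.projJ s), vec m n H (w - P.projJ w)⟫ +
        ⟪vec m n H (P.projJ (s - s')), vec m n H (P.projJ w)⟫ := by
  simp only [map_sub, inner_sub_left, inner_sub_right, inner_vec_projJ, projJ_projJ]
  ring

/-- The identity block gives `stackZ` a left inverse; multiplying the first Penrose equation by it
turns the pseudoinverse into a left inverse too. -/
theorem pinv_stackZ_mul_stackZ : pinv P.stackZ * P.stackZ = 1 := by
  have h1 : Matrix.fromCols (0 : Matrix (Fin M × Fin N) (Fin h) ℝ)
          (1 : Matrix (Fin M × Fin N) (Fin M × Fin N) ℝ) * P.stackZ = 1 := by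
    rw [stackZ, Matrix.fromCols_mul_fromRows]
    simp
  calc pinv P.stackZ * P.stackZ
      = (Matrix.fromCols (0 : Matrix (Fin M × Fin N) (Fin h) ℝ)
          (1 : Matrix (Fin M × Fin N) (Fin M × Fin N) ℝ) * P.stackZ) *
          (pinv P.stackZ * P.stackZ) := by rw [h1, Matrix.one_mul]
    _ = Matrix.fromCols (0 : Matrix (Fin M × Fin N) (Fin h) ℝ)
          (1 : Matrix (Fin M × Fin N) (Fin M × Fin N) ℝ) *
          (P.stackZ * pinv P.stackZ * P.stackZ) := by simp only [Matrix.mul_assoc]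
    _ = 1 := by rw [(pinv_penrose P.stackZ).1, h1]

theorem mode3_add_stepAB (μ₂ : ℝ) (X : Tensor M N L) (O₂ : Tensor M N h) :
    mode3 P.Z (P.stepAB μ₂ X O₂).toCols₁ + fold3 (P.stepAB μ₂ X O₂).toCols₂ =
      P.specMap X + μ₂⁻¹ • O₂ := by
  refine unfold3_injective ?_
  rw [unfold3_add, mode3, unfold3_fold3, unfold3_fold3]
  have h1 : (P.stepAB μ₂ X O₂).toCols₁ * unfold3 P.Z + (P.stepAB μ₂ X O₂).toCols₂ =
      P.stepAB μ₂ X O₂ * P.stackZ := by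
    conv_rhs => rw [← Matrix.fromCols_toCols (P.stepAB μ₂ X O₂), stackZ,
      Matrix.fromCols_mul_fromRows, Matrix.mul_one]
  rw [h1, stepAB, Matrix.mul_assoc, pinv_stackZ_mul_stackZ, Matrix.mul_one]
  rfl

theorem continuous_stepτ (μ₁ : ℝ) :
    Continuous fun z : Tensor M N L × Tensor m n H => P.stepτ μ₁ z.1 z.2 := by
  have h1 : Continuous fun z : Tensor M N L × Tensor m n H =>
      P.Hspa (mode3 z.1 P.D) + μ₁⁻¹ • z.2 - P.warped := by
    have h2 : Continuous P.spaMap := P.spaMap.continuous_of_finiteDimensional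
    change Continuous fun z : Tensor M N L × Tensor m n H =>
      P.spaMap z.1 + μ₁⁻¹ • z.2 - P.warped
    fun_prop
  refine continuous_finsetSum _ fun b _ => ?_
  exact ((continuous_const.matrix_mul (continuous_unfold3.comp h1).matrix_transpose).matrix_mul
    continuous_const)

theorem continuous_stepAB (μ₂ : ℝ) :
    Continuous fun z : Tensor M N L × Tensor M N h => P.stepAB μ₂ z.1 z.2 := by
  have h1 : Continuous fun z : Tensor M N L × Tensor M N h =>
      P.Hspec (mode3 z.1 P.D) + μ₂⁻¹ • z.2 := by
    have h2 : Continuous P.specMap := P.specMap.continuous_of_finiteDimensional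
    change Continuous fun z : Tensor M N L × Tensor M N h => P.specMap z.1 + μ₂⁻¹ • z.2
    fun_prop
  exact (continuous_unfold3.comp h1).matrix_mul continuous_const

theorem continuous_stepAB_toCols₁ (μ₂ : ℝ) :
    Continuous fun z : Tensor M N L × Tensor M N h => (P.stepAB μ₂ z.1 z.2).toCols₁ :=
  continuous_matrix fun i j => (P.continuous_stepAB μ₂).matrix_elem i (Sum.inl j)

theorem continuous_fold3_stepAB_toCols₂ (μ₂ : ℝ) :
    Continuous fun z : Tensor M N L × Tensor M N h => fold3 (P.stepAB μ₂ z.1 z.2).toCols₂ :=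
  continuous_fold3.comp <|
    continuous_matrix fun i j => (P.continuous_stepAB μ₂).matrix_elem i (Sum.inr j)

end Data

end RAF

namespace RAF

open Filter Topology RealInnerProductSpace

/-! ### Reduction to a problem in ℒ alone. -/

namespace Data

variable {M N H m n h L p : ℕ} (P : Data M N H m n h L p)

theorem Θ_eq (μ₁ μ₂ : ℝ) (X : Tensor M N L) (Δτ : Matrix (Fin p) (Fin H) ℝ)
    (A : Matrix (Fin h) (Fin h) ℝ) (C : Tensor M N h) (O₁ : Tensor m n H) (O₂ : Tensor M N h) :
    P.Θ μ₁ μ₂ X Δτ A C O₁ O₂ = μ₁ / 2 * ‖vec m n H (P.res1 X Δτ + μ₁⁻¹ • O₁)‖ ^ 2 +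
      μ₂ / 2 * ‖vec M N h (P.res2 X A C + μ₂⁻¹ • O₂)‖ ^ 2 + tnn X := by
  rw [norm_vec_sq, norm_vec_sq, Θ]

/-- `X ↦ ℋ_spa(X ×₃ D)`, vectorized and projected onto the orthogonal complement of the range
of `𝒥`. -/
noncomputable def normalMap : Tensor M N L →L[ℝ] EuclideanSpace ℝ (Fin m × Fin n × Fin H) :=
  LinearMap.toContinuousLinearMap
    ((vec m n H).toLinearMap ∘ₗ (LinearMap.id - P.projJ) ∘ₗ P.spaMap)

/-- `X ↦ ℋ_spa(X ×₃ D)`, vectorized and projected onto the range of `𝒥`. -/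
noncomputable def tangentMap : Tensor M N L →L[ℝ] EuclideanSpace ℝ (Fin m × Fin n × Fin H) :=
  LinearMap.toContinuousLinearMap ((vec m n H).toLinearMap ∘ₗ P.projJ ∘ₗ P.spaMap)

/-- `X ↦ ℋ_spec(X ×₃ D)`, vectorized. -/
noncomputable def specVec : Tensor M N L →L[ℝ] EuclideanSpace ℝ (Fin M × Fin N × Fin h) :=
  LinearMap.toContinuousLinearMap ((vec M N h).toLinearMap ∘ₗ P.specMap)

/-- `X ↦ ℋ_spa(X ×₃ D)`, vectorized. -/
noncomputable def spaVec : Tensor M N L →L[ℝ] EuclideanSpace ℝ (Fin m × Fin n × Fin H) :=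
  LinearMap.toContinuousLinearMap ((vec m n H).toLinearMap ∘ₗ P.spaMap)

/-- The right-hand side of the projected first constraint. -/
noncomputable def normalRhs : EuclideanSpace ℝ (Fin m × Fin n × Fin H) :=
  vec m n H (P.warped - P.projJ P.warped)

theorem normalMap_apply (X : Tensor M N L) :
    P.normalMap X = vec m n H (P.spaMap X - P.projJ (P.spaMap X)) := rfl

theorem tangentMap_apply (X : Tensor M N L) :
    P.tangentMap X = vec m n H (P.projJ (P.spaMap X)) := rfl

theorem specVec_apply (X : Tensor M N L) : P.specVec X = vec M N h (P.specMap X) := rfl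

theorem spaVec_apply (X : Tensor M N L) : P.spaVec X = vec m n H (P.spaMap X) := rfl

theorem normalMap_eq_of_feasible {X : Tensor M N L} {Δτ : Matrix (Fin p) (Fin H) ℝ}
    {A : Matrix (Fin h) (Fin h) ℝ} {C : Tensor M N h} (hX : P.Feasible X Δτ A C) :
    P.normalMap X = P.normalRhs := by
  have h1 : P.spaMap X = P.warped + P.J Δτ := hX.1
  rw [normalMap_apply, normalRhs, h1, map_add, projJ_J]
  congr 1
  abel

theorem inner_normalMap (l : EuclideanSpace ℝ (Fin m × Fin n × Fin H)) (X : Tensor M N L) :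
    ⟪l, P.normalMap X⟫ = ⟪vec m n H ((vec m n H).symm l - P.projJ ((vec m n H).symm l)),
      P.spaVec X⟫ := by
  obtain ⟨u, rfl⟩ := (vec m n H).surjective l
  simp only [normalMap_apply, spaVec_apply, ContinuousLinearEquiv.symm_apply_apply, map_sub,
    inner_sub_left, inner_sub_right, inner_vec_projJ]

section Uniqueness

variable {P} {μ₁ μ₂ : ℝ}

/-- Equal multipliers and images force equal objective values. For suitable multipliers of `Θ`, `X`
is a minimizer and `X'` has the same value, so well-posedness identifies them. -/
theorem eq_of_isKKT (hμ₁ : 0 < μ₁) (hμ₂ : 0 < μ₂)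
    (hargmin : ∀ Δτ A C O₁ O₂,
      {X | IsMinOn (fun X' => P.Θ μ₁ μ₂ X' Δτ A C O₁ O₂) Set.univ X}.Subsingleton)
    {X X' : Tensor M N L} {l : EuclideanSpace ℝ (Fin m × Fin n × Fin H)}
    (hX : IsKKT (tnnSeminorm M N L) P.normalMap P.normalRhs X l)
    (hX' : IsKKT (tnnSeminorm M N L) P.normalMap P.normalRhs X' l)
    (ht : P.tangentMap X = P.tangentMap X') (hs : P.specVec X = P.specVec X') : X = X' := by
  have hspa : P.spaVec X' = P.spaVec X := by
    have h1 : ∀ Y, P.spaVec Y = P.normalMap Y + P.tangentMap Y := fun Y => by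
      rw [normalMap_apply, tangentMap_apply, spaVec_apply, ← map_add, sub_add_cancel]
    rw [h1, h1, hX.1, hX'.1, ht]
  have htnn : tnn X' = tnn X := by
    have h1 := hX.2 X'
    have h2 := hX'.2 X
    rw [map_sub, hX.1, hX'.1, sub_self, inner_zero_right, add_zero] at h1 h2
    exact le_antisymm h2 h1
  -- `O₁` and `O₂` are chosen so that the two squares in `Θ` become those of spa(Y − X) + k/μ₁ and
  -- spec(Y − X). The cross term is then the multiplier term of the Karush–Kuhn–Tucker inequality.
  set k := (vec m n H).symm l - P.projJ ((vec m n H).symm l) with hk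
  set O₁ := k - μ₁ • P.res1 X 0 with hO₁
  set O₂ := -(μ₂ • P.res2 X 0 0) with hO₂
  have hΘ : ∀ Y, P.Θ μ₁ μ₂ Y 0 0 0 O₁ O₂ =
      μ₁ / 2 * ‖P.spaVec (Y - X) + μ₁⁻¹ • vec m n H k‖ ^ 2 +
        μ₂ / 2 * ‖P.specVec (Y - X)‖ ^ 2 + tnn Y := by
    intro Y
    have e₁ : P.res1 Y 0 + μ₁⁻¹ • O₁ = P.spaMap (Y - X) + μ₁⁻¹ • k := by
      rw [hO₁, smul_sub, inv_smul_smul₀ hμ₁.ne', res1_eq, res1_eq, map_sub]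
      abel
    have e₂ : P.res2 Y 0 0 + μ₂⁻¹ • O₂ = P.specMap (Y - X) := by
      rw [hO₂, smul_neg, inv_smul_smul₀ hμ₂.ne', res2_eq, res2_eq, map_sub]
      abel
    rw [Θ_eq, e₁, e₂, map_add, map_smul]
    rfl
  have hmin : ∀ Y, P.Θ μ₁ μ₂ X 0 0 0 O₁ O₂ ≤ P.Θ μ₁ μ₂ Y 0 0 0 O₁ O₂ := by
    intro Y
    have h1 := hX.2 Y
    rw [inner_normalMap, ← hk, tnnSeminorm_apply, tnnSeminorm_apply] at h1
    rw [hΘ, hΘ, sub_self, map_zero, map_zero, zero_add, norm_zero, norm_add_sq_real,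
      inner_smul_right, real_inner_comm]
    have h2 : μ₁ / 2 * (2 * (μ₁⁻¹ * ⟪vec m n H k, P.spaVec (Y - X)⟫)) =
        ⟪vec m n H k, P.spaVec (Y - X)⟫ := by
      field_simp
    nlinarith [show 0 ≤ μ₁ / 2 * ‖P.spaVec (Y - X)‖ ^ 2 by positivity,
      show 0 ≤ μ₂ / 2 * ‖P.specVec (Y - X)‖ ^ 2 by positivity]
  have heq : P.Θ μ₁ μ₂ X' 0 0 0 O₁ O₂ = P.Θ μ₁ μ₂ X 0 0 0 O₁ O₂ := by
    rw [hΘ, hΘ, map_sub P.spaVec X' X, map_sub P.specVec X' X, hspa, ← hs, htnn]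
    simp only [sub_self, map_zero]
  exact hargmin 0 0 0 O₁ O₂ (fun Y _ => hmin Y) fun Y _ => heq.trans_le (hmin Y)

end Uniqueness

section Limit

variable {P}

theorem tangent_eq_of_normalMap_eq {X : Tensor M N L} (hX : P.normalMap X = P.normalRhs) :
    P.projJ (P.spaMap X - P.warped) = P.spaMap X - P.warped := by
  rw [normalMap_apply, normalRhs] at hX
  have h1 := (vec m n H).injective hX
  rw [map_sub]
  linear_combination -h1

/-- The reduced constraint puts ℋ_spa(X ×₃ 𝐃) − 𝒴∘τ in the range of 𝒥. With Π𝒪₁ = 0 and 𝒪₂ = 0 the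
least-squares updates therefore solve both constraints exactly. -/
theorem feasible_of_normalMap_eq {μ₁ μ₂ : ℝ} {X : Tensor M N L} {O₁ : Tensor m n H}
    (hX : P.normalMap X = P.normalRhs) (hO₁ : P.projJ O₁ = 0) :
    P.Feasible X (P.stepτ μ₁ X O₁) (P.stepAB μ₂ X 0).toCols₁
      (fold3 (P.stepAB μ₂ X 0).toCols₂) := by
  constructor
  · rw [J_stepτ, add_sub_right_comm, map_add, tangent_eq_of_normalMap_eq hX, map_smul, hO₁,
      smul_zero, add_zero, add_sub_cancel]
    rfl
  · rw [mode3_add_stepAB, smul_zero, add_zero]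
    rfl

variable {X : Tensor M N L} {Δτ : Matrix (Fin p) (Fin H) ℝ} {A : Matrix (Fin h) (Fin h) ℝ}
  {C : Tensor M N h} {l : EuclideanSpace ℝ (Fin m × Fin n × Fin H)}

theorem isPrimalOptimal_of_isKKT (hX : IsKKT (tnnSeminorm M N L) P.normalMap P.normalRhs X l)
    (hfeas : P.Feasible X Δτ A C) : P.IsPrimalOptimal X Δτ A C := by
  refine ⟨hfeas, fun X' Δτ' A' C' h' => ?_⟩
  have h1 := hX.2 X'
  rwa [map_sub, hX.1, P.normalMap_eq_of_feasible h', sub_self, inner_zero_right, add_zero] at h1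

/-- Weak duality bounds every dual value by `tnn X`. At this multiplier the bound is attained: it is
orthogonal to the range of 𝒥, so Δτ drops out, and 𝐀, ℬ drop out because the second multiplier is 0.
-/
theorem isDualOptimal_of_isKKT (hX : IsKKT (tnnSeminorm M N L) P.normalMap P.normalRhs X l)
    (hfeas : P.Feasible X Δτ A C) (hl : P.projJ ((vec m n H).symm l) = 0) :
    P.IsDualOptimal ((vec m n H).symm l) 0 := by
  intro O₁' O₂'
  have hup : P.dual O₁' O₂' ≤ ((tnn X : ℝ) : EReal) := by
    refine iInf_le_of_le X <| iInf_le_of_le Δτ <| iInf_le_of_le A <| iInf_le_of_le C ?_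
    have h1 : P.res1 X Δτ = 0 := sub_eq_zero.mpr hfeas.1
    have h2 : P.res2 X A C = 0 := sub_eq_zero.mpr hfeas.2
    rw [lagrangian, h1, h2]
    simp [tinner]
  refine hup.trans ?_
  refine le_iInf fun Y => le_iInf fun Δ => le_iInf fun A' => le_iInf fun C' => ?_
  rw [EReal.coe_le_coe_iff]
  have h1 := hX.2 Y
  rw [inner_normalMap, hl, sub_zero] at h1
  have h2 : ⟪vec m n H ((vec m n H).symm l), vec m n H (P.J Δ)⟫ = 0 := by
    rw [← projJ_J, ← inner_vec_projJ, hl, map_zero, inner_zero_left]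
  have h3 : ⟪vec m n H ((vec m n H).symm l), vec m n H (P.J Δτ)⟫ = 0 := by
    rw [← projJ_J, ← inner_vec_projJ, hl, map_zero, inner_zero_left]
  have h4 : P.spaMap X = P.warped + P.J Δτ := hfeas.1
  have h5 : tinner (0 : Tensor M N h) (P.res2 Y A' C') = 0 := by simp [tinner]
  rw [spaVec_apply, map_sub P.spaMap, h4] at h1
  rw [lagrangian, h5, ← inner_vec, res1_eq]
  simp only [map_sub, map_add, inner_sub_right, inner_add_right, tnnSeminorm_apply, h2, h3] at h1 ⊢
  linarith

end Limit

/-! ### The algorithm as a proximal augmented Lagrangian method. -/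

namespace IsSGSADMM

variable {P} {μ₁ μ₂ ρ : ℝ} {X : ℕ → Tensor M N L} {Δτ : ℕ → Matrix (Fin p) (Fin H) ℝ}
  {A : ℕ → Matrix (Fin h) (Fin h) ℝ} {C : ℕ → Tensor M N h}
  {O₁ : ℕ → Tensor m n H} {O₂ : ℕ → Tensor M N h}

theorem res1_succ (halg : P.IsSGSADMM μ₁ μ₂ ρ X Δτ A C O₁ O₂) (t : ℕ) :
    P.res1 (X (t + 1)) (Δτ (t + 1)) = (P.spaMap (X (t + 1)) - P.warped) -
      P.projJ (P.spaMap (X (t + 1)) - P.warped) - μ₁⁻¹ • P.projJ (O₁ t) := by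
  rw [halg.step_τ, res1_eq, J_stepτ, add_sub_right_comm, map_add, map_smul]
  abel

theorem projJ_O₁ (halg : P.IsSGSADMM μ₁ μ₂ ρ X Δτ A C O₁ O₂) (hμ₁ : μ₁ ≠ 0) (t : ℕ) :
    P.projJ (O₁ t) = (1 - ρ) ^ t • P.projJ (O₁ 0) := by
  induction t with
  | zero => simp
  | succ t ih =>
    have h1 : P.projJ (O₁ (t + 1)) = (1 - ρ) • P.projJ (O₁ t) := by
      rw [halg.step_O₁, halg.res1_succ]
      simp only [map_add, map_sub, map_smul, projJ_projJ, sub_self, zero_sub, smul_neg, smul_smul]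
      rw [mul_assoc, mul_inv_cancel₀ hμ₁]
      module
    rw [h1, ih, smul_smul, pow_succ']

theorem mode3_add_succ (halg : P.IsSGSADMM μ₁ μ₂ ρ X Δτ A C O₁ O₂) (t : ℕ) :
    mode3 P.Z (A (t + 1)) + C (t + 1) = P.specMap (X (t + 1)) + μ₂⁻¹ • O₂ t := by
  rw [halg.step_A, halg.step_C, mode3_add_stepAB]

theorem O₂_eq (halg : P.IsSGSADMM μ₁ μ₂ ρ X Δτ A C O₁ O₂) (hμ₂ : μ₂ ≠ 0) (t : ℕ) :
    O₂ t = (1 - ρ) ^ t • O₂ 0 := by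
  induction t with
  | zero => simp
  | succ t ih =>
    have h1 : O₂ (t + 1) = (1 - ρ) • O₂ t := by
      rw [halg.step_O₂, res2_eq, halg.mode3_add_succ, sub_add_cancel_left, smul_neg, smul_smul,
        mul_assoc, mul_inv_cancel₀ hμ₂]
      module
    rw [h1, ih, smul_smul, pow_succ']

/-- The part of the multiplier `O₁` orthogonal to the range of `𝒥`. -/
noncomputable def normalMultiplier (P : Data M N H m n h L p) (O₁ : ℕ → Tensor m n H) (t : ℕ) :
    EuclideanSpace ℝ (Fin m × Fin n × Fin H) :=
  vec m n H (O₁ t - P.projJ (O₁ t))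

/-- The deviation of the second block from its exact value at the current iterate. -/
noncomputable def specError (P : Data M N H m n h L p) (μ₂ : ℝ) (X : ℕ → Tensor M N L)
    (A : ℕ → Matrix (Fin h) (Fin h) ℝ) (C : ℕ → Tensor M N h) (O₂ : ℕ → Tensor M N h) (t : ℕ) :
    EuclideanSpace ℝ (Fin M × Fin N × Fin h) :=
  vec M N h (mode3 P.Z (A t) + C t - μ₂⁻¹ • O₂ t - P.specMap (X t))

theorem summable_specError (halg : P.IsSGSADMM μ₁ μ₂ ρ X Δτ A C O₁ O₂) (hμ₂ : μ₂ ≠ 0)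
    (hρ : |1 - ρ| < 1) : Summable fun t => ‖specError P μ₂ X A C O₂ t‖ := by
  -- The term t = 0 depends on the arbitrary starting point; every later one is a difference of
  -- consecutive 𝒪₂/μ₂, hence geometric.
  rw [← summable_nat_add_iff 1]
  have h1 : ∀ t, specError P μ₂ X A C O₂ (t + 1) =
      (1 - ρ) ^ t • vec M N h ((μ₂⁻¹ * ρ) • O₂ 0) := by
    intro t
    rw [specError, halg.mode3_add_succ, halg.O₂_eq hμ₂ (t + 1), halg.O₂_eq hμ₂ t, ← map_smul]
    congr 1
    module
  simp only [h1, norm_smul, norm_pow, Real.norm_eq_abs]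
  exact (summable_geometric_of_lt_one (abs_nonneg _) hρ).mul_right _

/-- The half step puts Πs' into the ℒ-problem, where s' is computed from the old ℒ. Orthogonal
splitting of its optimality condition yields the penalty and the `tangentMap` term; the old (𝐀, ℬ)
yields the `specVec` term with its error. -/
theorem isProxAugLagrangian (halg : P.IsSGSADMM μ₁ μ₂ ρ X Δτ A C O₁ O₂) (hμ₁ : 0 < μ₁)
    (hμ₂ : 0 < μ₂) (hρ : |1 - ρ| < 1) :
    IsProxAugLagrangian (tnnSeminorm M N L) P.normalMap P.normalRhs P.tangentMap P.specVec
      μ₁ μ₂ ρ X (normalMultiplier P O₁) (specError P μ₂ X A C O₂) where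
  summable := halg.summable_specError hμ₂.ne' hρ
  mult t := by
    rw [normalMultiplier, normalMultiplier, normalMap_apply, normalRhs, ← map_sub, ← map_smul,
      ← map_add, halg.step_O₁, halg.res1_succ]
    congr 1
    simp only [map_add, map_sub, map_smul, projJ_projJ]
    module
  step t Y := by
    set X' := X (t + 1) with hX'
    set s := P.spaMap X' + μ₁⁻¹ • O₁ t - P.warped with hs
    set s' := P.spaMap (X t) + μ₁⁻¹ • O₁ t - P.warped with hs'
    have hres1 : ∀ Z, P.res1 Z (P.stepτ μ₁ (X t) (O₁ t)) + μ₁⁻¹ • O₁ t =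
        P.spaMap Z + (μ₁⁻¹ • O₁ t - P.warped - P.projJ s') := by
      intro Z
      rw [res1_eq, J_stepτ]
      abel
    have hres2 : ∀ Z, P.res2 Z (A t) (C t) + μ₂⁻¹ • O₂ t =
        P.specMap Z + (μ₂⁻¹ • O₂ t - (mode3 P.Z (A t) + C t)) := by
      intro Z
      rw [res2_eq]
      abel
    have hmin := halg.step_L t
    have hvi := variational_inequality_of_isMinOn (tnnSeminorm M N L) P.spaVec P.specVec
      (vec m n H (μ₁⁻¹ • O₁ t - P.warped - P.projJ s'))
      (vec M N h (μ₂⁻¹ • O₂ t - (mode3 P.Z (A t) + C t))) μ₁ μ₂ (x := X') (fun Z => by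
        have h1 : P.Θ μ₁ μ₂ X' (P.stepτ μ₁ (X t) (O₁ t)) (A t) (C t) (O₁ t) (O₂ t) ≤
          P.Θ μ₁ μ₂ Z (P.stepτ μ₁ (X t) (O₁ t)) (A t) (C t) (O₁ t) (O₂ t) :=
          hmin (Set.mem_univ Z)
        rw [Θ_eq, Θ_eq, hres1, hres1, hres2, hres2] at h1
        simpa only [spaVec_apply, specVec_apply, ← map_add, tnnSeminorm_apply] using h1) Y
    refine hvi.trans (le_of_eq ?_)
    have e₁ : P.spaVec X' + vec m n H (μ₁⁻¹ • O₁ t - P.warped - P.projJ s') =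
        vec m n H (s - P.projJ s') := by
      rw [spaVec_apply, ← map_add]
      congr 1
      rw [hs]
      abel
    have e₂ : P.specVec X' + vec M N h (μ₂⁻¹ • O₂ t - (mode3 P.Z (A t) + C t)) =
        P.specVec (X' - X t) - specError P μ₂ X A C O₂ t := by
      rw [specVec_apply, specVec_apply, specError, ← map_add, ← map_sub, map_sub P.specMap]
      congr 1
      abel
    have e₃ : normalMultiplier P O₁ t + μ₁ • (P.normalMap X' - P.normalRhs) =
        μ₁ • vec m n H (s - P.projJ s) := by
      rw [normalMultiplier, normalMap_apply, normalRhs, ← map_sub, ← map_smul, ← map_add,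
        ← map_smul, hs]
      congr 1
      simp only [map_add, map_sub, map_smul, smul_add, smul_sub, smul_inv_smul₀ hμ₁.ne']
      abel
    have e₄ : P.tangentMap (X' - X t) = vec m n H (P.projJ (s - s')) := by
      rw [tangentMap_apply, hs, hs', map_sub]
      congr 2
      abel
    rw [e₁, e₂, e₃, e₄, inner_smul_left, spaVec_apply, inner_vec_sub_projJ, normalMap_apply,
      tangentMap_apply, conj_trivial]
    ring

end IsSGSADMM

end Data

end RAF

/-! ### Convergence of all blocks. -/

theorem theorem4p2 {M N H m n h L p : ℕ} (P : RAF.Data M N H m n h L p)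
    (hwarp : ∀ b, ContDiff ℝ 2 (P.warpBand b))
    (hfeas : ∃ X Δτ A C, P.Feasible X Δτ A C)
    (μ₁ μ₂ ρ : ℝ) (hμ₁ : 0 < μ₁) (hμ₂ : 0 < μ₂)
    (hρ₀ : 0 < ρ) (hρ : ρ < (1 + Real.sqrt 5) / 2)
    (hargmin : ∀ Δτ A C O₁ O₂,
      {X | IsMinOn (fun X' => P.Θ μ₁ μ₂ X' Δτ A C O₁ O₂) Set.univ X}.Subsingleton)
    (X : ℕ → RAF.Tensor M N L) (Δτ : ℕ → Matrix (Fin p) (Fin H) ℝ)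
    (A : ℕ → Matrix (Fin h) (Fin h) ℝ) (C : ℕ → RAF.Tensor M N h)
    (O₁ : ℕ → RAF.Tensor m n H) (O₂ : ℕ → RAF.Tensor M N h)
    (halg : P.IsSGSADMM μ₁ μ₂ ρ X Δτ A C O₁ O₂) :
    (∃ Xs Δτs As Cs, P.IsPrimalOptimal Xs Δτs As Cs ∧
      Filter.Tendsto X Filter.atTop (nhds Xs) ∧
      Filter.Tendsto Δτ Filter.atTop (nhds Δτs) ∧
      Filter.Tendsto A Filter.atTop (nhds As) ∧
      Filter.Tendsto C Filter.atTop (nhds Cs)) ∧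
    (∃ O₁s O₂s, P.IsDualOptimal O₁s O₂s ∧
      Filter.Tendsto O₁ Filter.atTop (nhds O₁s) ∧
      Filter.Tendsto O₂ Filter.atTop (nhds O₂s)) := by
  have hρ2 : ρ < 2 := by
    have h5 : Real.sqrt 5 < 3 := by
      rw [Real.sqrt_lt' (by norm_num)]
      norm_num
    linarith
  have habs : |1 - ρ| < 1 := abs_lt.mpr ⟨by linarith, by linarith⟩
  obtain ⟨X₀, Δτ₀, A₀, C₀, h₀⟩ := hfeas
  obtain ⟨Xs, ls, hs, hX, hl⟩ := (halg.isProxAugLagrangian hμ₁ hμ₂ habs).exists_tendsto hμ₁ hμ₂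
    hρ₀ hρ2 (fun _ hx => RAF.eq_zero_of_tnn_eq_zero hx) ⟨X₀, P.normalMap_eq_of_feasible h₀⟩
    (fun _ _ _ h1 h2 => RAF.Data.eq_of_isKKT hμ₁ hμ₂ hargmin h1 h2)
  set O₁s := (RAF.vec m n H).symm ls with hO₁s
  have hpow := tendsto_pow_atTop_nhds_zero_of_abs_lt_one habs
  have hproj : Filter.Tendsto (fun t => P.projJ (O₁ t)) Filter.atTop (nhds 0) := by
    have h1 := hpow.smul_const (P.projJ (O₁ 0))
    rw [zero_smul] at h1
    exact h1.congr fun t => (halg.projJ_O₁ hμ₁.ne' t).symm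
  -- The normal part of the multiplier converges by the reduced method, the tangential part
  -- geometrically to 0.
  have hO₁ : Filter.Tendsto O₁ Filter.atTop (nhds O₁s) := by
    have h1 := (((RAF.vec m n H).symm.continuous.tendsto ls).comp hl).add hproj
    rw [add_zero] at h1
    refine h1.congr fun t => ?_
    change (RAF.vec m n H).symm (RAF.vec m n H (O₁ t - P.projJ (O₁ t))) + P.projJ (O₁ t) = O₁ t
    rw [ContinuousLinearEquiv.symm_apply_apply, sub_add_cancel]
  have hO₂ : Filter.Tendsto O₂ Filter.atTop (nhds 0) := by
    have h1 := hpow.smul_const (O₂ 0)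
    rw [zero_smul] at h1
    exact h1.congr fun t => (halg.O₂_eq hμ₂.ne' t).symm
  have hprojs : P.projJ O₁s = 0 := tendsto_nhds_unique
    ((P.projJ.continuous_of_finiteDimensional.tendsto O₁s).comp hO₁) hproj
  have hfeas := RAF.Data.feasible_of_normalMap_eq (μ₁ := μ₁) (μ₂ := μ₂) hs.1 hprojs
  -- The updates at t + 1 combine the new ℒ with the old multipliers, so their limits are the update
  -- formulas at (Xs, O₁s) and (Xs, 0).
  have hX1 := hX.comp (Filter.tendsto_add_atTop_nat 1)
  have hτ := (((P.continuous_stepτ μ₁).tendsto (Xs, O₁s)).comp (hX1.prodMk_nhds hO₁)).congr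
    fun t => (halg.step_τ t).symm
  have hA := (((P.continuous_stepAB_toCols₁ μ₂).tendsto (Xs, 0)).comp
    (hX1.prodMk_nhds hO₂)).congr fun t => (halg.step_A t).symm
  have hC := (((P.continuous_fold3_stepAB_toCols₂ μ₂).tendsto (Xs, 0)).comp
    (hX1.prodMk_nhds hO₂)).congr fun t => (halg.step_C t).symm
  exact ⟨⟨Xs, _, _, _, RAF.Data.isPrimalOptimal_of_isKKT hs hfeas, hX,
    (Filter.tendsto_add_atTop_iff_nat 1).mp hτ, (Filter.tendsto_add_atTop_iff_nat 1).mp hA,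
    (Filter.tendsto_add_atTop_iff_nat 1).mp hC⟩,
    O₁s, 0, RAF.Data.isDualOptimal_of_isKKT hs hfeas hprojs, hO₁, hO₂⟩
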